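/- Let $\mathbb{T}^d=\mathbb{R}^d/\mathbb{Z}^d$ be the flat torus with the normalised Lebesgue measure, let $T>0$, $b\in L^\infty(\mathbb{T}^d;\mathbb{R}^d)$ and $p_0\in L^2(\mathbb{T}^d)$. For $F\in L^2(0,T;L^2(\mathbb{T}^d;\mathbb{R}^d))$ and $u_0\in L^2(\mathbb{T}^d)$, a variational solution on $[0,T]$ of $\partial_t u=\tfrac12\Delta u-\mathrm{div}(bu)-\mathrm{div}F$, $u|_{t=0}=u_0$, is a function $u\in C([0,T];L^2(\mathbb{T}^d))\cap L^2(0,T;H^1(\mathbb{T}^d))$ such that for all $v\in H^1(\mathbb{T}^d)$ and $t\in[0,T]$ $$\int_{\mathbb{T}^d}u(t)\,v\,dx=\int_{\mathbb{T}^d}u_0\,v\,dx+\int_0^t\int_{\mathbb{T}^d}\Big(-\tfrac12\nabla u(s)\cdot\nabla v+(b\,u(s)+F(s))\cdot\nabla v\Big)\,dx\,ds .$$ The Fokker--Planck equation $$\partial_t p=\tfrac12\Delta p-\mathrm{div}(b\,p),\qquad p|_{t=0}=p_0,$$ has a unique variational solution $p=p^{0,p_0}$ on $[0,T]$, and for every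 $\eta\in L^\infty(\mathbb{T}^d;\mathbb{R}^d)$ the problem $$\partial_t\dot r=\tfrac12\Delta\dot r-\mathrm{div}(b\,\dot r)-\mathrm{div}(\eta\,p^{0,p_0}),\qquad \dot r|_{t=0}=0,$$ has a unique variational solution $\dot r=\dot r^{p_0,\eta}$ on $[0,T]$. For every fixed $\tau\in(0,T]$ the map $$L^\infty(\mathbb{T}^d;\mathbb{R}^d)\to L^2(\mathbb{T}^d),\qquad \eta\mapsto\dot r^{p_0,\eta}(\tau),$$ is linear and continuous. More precisely, there is a constant $K>0$ that depends only on $d$, $T$ and (an upper bound for) $\|b\|_\infty$ such that, for all $p_0\in L^2(\mathbb{T}^d)$, $\eta\in L^\infty(\mathbb{T}^d;\mathbb{R}^d)$ and $\tau\in(0,T]$, $$\|\dot r^{p_0,\eta}(\tau)\|_2\le K\,\tau^{1/2}\,\|p_0\|_2\,\|\eta\|_\infty .$$ Moreover $\int_{\mathbb{T}^d}\dot r^{p_0,\eta}(\tau)\,dx=0$ for every $\eta\in L^\infty(\mathbb{T}^d;\mathbb{R}^d)$. -/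

import Mathlib

open MeasureTheory Set
open scoped ENNReal ContDiff

noncomputable section

namespace FokkerPlanck

/-- The flat torus `𝕋^d = ℝ^d / ℤ^d`. -/
abbrev Torus (d : ℕ) : Type := UnitAddTorus (Fin d)

/-- The normalised Lebesgue measure on `𝕋^d` (the product of the Haar probability measures
of the circles `ℝ / ℤ`). -/
abbrev torusMeasure (d : ℕ) : Measure (Torus d) :=
  Measure.pi fun _ : Fin d => (AddCircle.haarAddCircle : Measure UnitAddCircle)

/-- `L²(𝕋^d)`, real valued. -/
abbrev L2 (d : ℕ) : Type := Lp ℝ 2 (torusMeasure d)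

/-- `L²(𝕋^d; ℝ^d)`, where `ℝ^d` carries the Euclidean norm. -/
abbrev L2Vec (d : ℕ) : Type := Lp (EuclideanSpace ℝ (Fin d)) 2 (torusMeasure d)

/-- `L^∞(𝕋^d; ℝ^d)`, where `ℝ^d` carries the Euclidean norm. -/
abbrev LinftyVec (d : ℕ) : Type := Lp (EuclideanSpace ℝ (Fin d)) ∞ (torusMeasure d)

/-- The product `u b ∈ L²(𝕋^d; ℝ^d)` of `u ∈ L²(𝕋^d)` and `b ∈ L^∞(𝕋^d; ℝ^d)`. -/
def flux {d : ℕ} (u : L2 d) (b : LinftyVec d) : L2Vec d := u • b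

/-- `φ ∈ C^∞(𝕋^d)`: the `ℤ^d`-periodic lift of `φ` to `ℝ^d` is smooth. -/
def IsSmooth {d : ℕ} (φ : Torus d → ℝ) : Prop :=
  ContDiff ℝ ∞ fun y : Fin d → ℝ => φ fun i => (y i : UnitAddCircle)

/-- The classical partial derivative `∂_i φ (x)` of a function on the torus. -/
def partialDeriv {d : ℕ} (i : Fin d) (φ : Torus d → ℝ) (x : Torus d) : ℝ :=
  deriv (fun s : ℝ => φ (x + Pi.single i (s : UnitAddCircle))) 0

/-- `G ∈ L²(𝕋^d; ℝ^d)` is the weak gradient of `u ∈ L²(𝕋^d)`. Hence `u ∈ H¹(𝕋^d)` if and only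
if such a `G` exists. -/
def HasWeakGradient {d : ℕ} (u : L2 d) (G : L2Vec d) : Prop :=
  ∀ φ : Torus d → ℝ, IsSmooth φ → ∀ i : Fin d,
    ∫ x, u x * partialDeriv i φ x ∂(torusMeasure d) = -∫ x, G x i * φ x ∂(torusMeasure d)

/-- `u` is a variational solution on `[0, T]` of
`∂ₜ u = ½ Δ u - div (b u) - div F`, `u(0) = u₀`, that is:
`u ∈ C([0, T]; L²) ∩ L²(0, T; H¹)` (with weak gradient `G ∈ L²(0, T; L²(𝕋^d; ℝ^d))`), and, for
every `v ∈ H¹(𝕋^d)`, the equation `⟨∂ₜ u, v⟩ = - ½ ∫ ∇u · ∇v + ∫ (b u + F) · ∇v` holds in its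
form integrated over `(0, t)`, for all `t ∈ [0, T]`. (This says that the derivative of `u` as a
function with values in `H⁻¹` is the right-hand side, which is in `L²(0, T; H⁻¹)` whenever
`F ∈ L²(0, T; L²)`, so that `u ∈ H¹(0, T; H⁻¹)`.) -/
def IsVariationalSolution {d : ℕ} (T : ℝ) (b : LinftyVec d) (F : ℝ → L2Vec d) (u₀ : L2 d)
    (u : ℝ → L2 d) : Prop :=
  ContinuousOn u (Icc 0 T) ∧ u 0 = u₀ ∧
    ∃ G : ℝ → L2Vec d, MemLp G 2 (volume.restrict (Ioc 0 T)) ∧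
      (∀ᵐ t ∂(volume.restrict (Ioc 0 T)), HasWeakGradient (u t) (G t)) ∧
      ∀ (v : L2 d) (w : L2Vec d), HasWeakGradient v w → ∀ t ∈ Icc 0 T,
        inner ℝ (u t) v = inner ℝ u₀ v +
          ∫ s in (0 : ℝ)..t, (-(1 / 2) * inner ℝ (G s) w + inner ℝ (flux (u s) b + F s) w)

/-- `p` solves the Fokker-Planck equation
`∂ₜ p = ½ Δ p - div (b p)`, `p(0) = p₀`, on `[0, T]`. -/
def IsFokkerPlanckSolution {d : ℕ} (T : ℝ) (b : LinftyVec d) (p₀ : L2 d) (p : ℝ → L2 d) : Prop :=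
  IsVariationalSolution T b (fun _ => 0) p₀ p

/-- `r` solves the linear response equation
`∂ₜ r = ½ Δ r - div (b r) - div (η p)`, `r(0) = 0`, on `[0, T]`. -/
def IsResponseSolution {d : ℕ} (T : ℝ) (b : LinftyVec d) (p : ℝ → L2 d) (η : LinftyVec d)
    (r : ℝ → L2 d) : Prop :=
  IsVariationalSolution T b (fun t => flux (p t) η) 0 r

end FokkerPlanck

end

/-! ### Gradients diagonalised by a Hilbert basis. -/

noncomputable section

/-! Everything follows from one energy estimate. The real Fourier (Hartley) basis diagonalises the
Laplacian, so testing the weak equation with a basis vector gives a scalar ODE whose forcing carries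
the square root of the eigenvalue, and the dissipation absorbs that factor. Summing over modes with
Parseval and Bessel gives `‖u(t)‖² ≤ ‖u₀‖² + 2∫‖g‖²` for `∂ₜu = ½Δu - div g`
(`IsSolution.norm_sq_le`), without a chain rule for `‖u‖²` in `H⁻¹`-`H¹` duality. The same mode
bounds make the series of mode solutions converge (`exists_isSolution`).

The drift is part of `g`: Gronwall gives `drift_norm_sq_le`, hence uniqueness, and Picard iteration
gives existence (`exists_isSolution_drift`).

For the response, `g = b r + η p` with `‖η p‖ ≤ C ‖p₀‖ ‖η‖` by the estimate for `p`. Since `r(0) =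
0`, the estimate for `‖r(τ)‖²` has a factor `τ`, whence `τ^{1/2}`. Linearity in `η` is superposition
plus uniqueness; zero mass comes from the test function `1`. As `p` is continuous in time with
values in `L²`, only forcings continuous in time are needed. -/

/-- A closed, densely defined gradient `∇ : H → V` (given by its graph) for which `∇* ∇` is
diagonalised by a Hilbert basis of `H`. -/
structure SpectralGradient (ι H V : Type*) [NormedAddCommGroup H] [InnerProductSpace ℝ H]
    [NormedAddCommGroup V] [InnerProductSpace ℝ V] where
  graph : Submodule ℝ (H × V)
  isClosed_graph : IsClosed (graph : Set (H × V))
  basis : HilbertBasis ι ℝ H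
  grad : ι → V
  eig : ι → ℝ
  basis_mem : ∀ i, (basis i, grad i) ∈ graph
  inner_grad : ∀ v w, (v, w) ∈ graph → ∀ i, inner ℝ w (grad i) = eig i * inner ℝ v (basis i)
  eq_zero : ∀ w, ((0 : H), w) ∈ graph → w = 0

namespace SpectralGradient

open Filter Topology

variable {ι H V : Type*} [NormedAddCommGroup H] [InnerProductSpace ℝ H]
    [NormedAddCommGroup V] [InnerProductSpace ℝ V] (D : SpectralGradient ι H V)

lemma inner_grad_self (i : ι) : inner ℝ (D.grad i) (D.grad i) = D.eig i := by
  rw [D.inner_grad _ _ (D.basis_mem i), real_inner_self_eq_norm_sq, D.basis.orthonormal.1 i]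
  simp

lemma inner_grad_of_ne {i j : ι} (h : i ≠ j) : inner ℝ (D.grad i) (D.grad j) = 0 := by
  rw [D.inner_grad _ _ (D.basis_mem i), D.basis.orthonormal.2 h, mul_zero]

lemma eig_nonneg (i : ι) : 0 ≤ D.eig i := by
  rw [← D.inner_grad_self]; exact real_inner_self_nonneg

/-- The normalised gradients of the basis vectors. -/
def unitGrad (i : ι) : V := (√(D.eig i))⁻¹ • D.grad i

/-- For a zero eigenvalue the inverse in `unitGrad` is `0`; the identity survives because `‖grad i‖²
= eig i` forces `grad i = 0`. -/
lemma grad_eq (i : ι) : D.grad i = √(D.eig i) • D.unitGrad i := by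
  rcases eq_or_ne (D.eig i) 0 with h | h
  · rw [h, Real.sqrt_zero, zero_smul, ← inner_self_eq_zero (𝕜 := ℝ), D.inner_grad_self, h]
  · have : √(D.eig i) ≠ 0 := (Real.sqrt_pos.2 ((D.eig_nonneg i).lt_of_ne' h)).ne'
    rw [unitGrad, smul_smul, mul_inv_cancel₀ this, one_smul]

lemma inner_grad_right (x : V) (i : ι) :
    inner ℝ x (D.grad i) = √(D.eig i) * inner ℝ x (D.unitGrad i) := by
  rw [D.grad_eq, inner_smul_right]

lemma inner_unitGrad_of_ne {i j : ι} (h : i ≠ j) :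
    inner ℝ (D.unitGrad i) (D.unitGrad j) = 0 := by
  simp [unitGrad, inner_smul_left, inner_smul_right, D.inner_grad_of_ne h]

lemma inner_unitGrad_self_le (i : ι) : inner ℝ (D.unitGrad i) (D.unitGrad i) ≤ 1 := by
  simp only [unitGrad, inner_smul_left, inner_smul_right, D.inner_grad_self]
  rcases eq_or_ne (D.eig i) 0 with h | h
  · simp [h]
  · have h1 : √(D.eig i) ≠ 0 := (Real.sqrt_pos.2 ((D.eig_nonneg i).lt_of_ne' h)).ne'
    have h2 := Real.mul_self_sqrt (D.eig_nonneg i)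
    simp only [conj_trivial]
    field_simp
    nlinarith

lemma norm_sum_smul_sq_of_orthogonal {w : ι → V} (hw : ∀ i j, i ≠ j → inner ℝ (w i) (w j) = 0)
    (S : Finset ι) (c : ι → ℝ) :
    ‖∑ i ∈ S, c i • w i‖ ^ 2 = ∑ i ∈ S, c i ^ 2 * inner ℝ (w i) (w i) := by
  rw [← real_inner_self_eq_norm_sq, sum_inner]
  refine Finset.sum_congr rfl fun i hi => ?_
  rw [inner_sum, Finset.sum_eq_single i]
  · simp only [inner_smul_left, inner_smul_right, conj_trivial]; ring
  · intro j _ hj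
    simp [inner_smul_left, inner_smul_right, hw i j hj.symm]
  · exact fun h => absurd hi h

/-- Bessel's inequality; it tolerates the vanishing `unitGrad i` at zero eigenvalues, since only
norms at most one are needed. -/
lemma sum_inner_unitGrad_sq_le (S : Finset ι) (x : V) :
    ∑ i ∈ S, inner ℝ x (D.unitGrad i) ^ 2 ≤ ‖x‖ ^ 2 := by
  have h0 : 0 ≤ ‖x - ∑ i ∈ S, inner ℝ x (D.unitGrad i) • D.unitGrad i‖ ^ 2 := sq_nonneg _
  rw [norm_sub_sq_real, norm_sum_smul_sq_of_orthogonal (fun i j => D.inner_unitGrad_of_ne),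
    inner_sum] at h0
  have h1 : ∑ i ∈ S, inner ℝ x (D.unitGrad i) ^ 2 * inner ℝ (D.unitGrad i) (D.unitGrad i) ≤
      ∑ i ∈ S, inner ℝ x (D.unitGrad i) ^ 2 := Finset.sum_le_sum fun i _ =>
    mul_le_of_le_one_right (sq_nonneg _) (D.inner_unitGrad_self_le i)
  have h2 : ∑ i ∈ S, inner ℝ x (inner ℝ x (D.unitGrad i) • D.unitGrad i) =
      ∑ i ∈ S, inner ℝ x (D.unitGrad i) ^ 2 := Finset.sum_congr rfl fun i _ => by
    rw [inner_smul_right, sq]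
  rw [h2] at h0
  linarith

lemma norm_sum_smul_grad_sq (S : Finset ι) (c : ι → ℝ) :
    ‖∑ i ∈ S, c i • D.grad i‖ ^ 2 = ∑ i ∈ S, D.eig i * c i ^ 2 := by
  rw [norm_sum_smul_sq_of_orthogonal (fun i j => D.inner_grad_of_ne)]
  simp only [D.inner_grad_self, mul_comm]

lemma norm_sum_smul_basis_sq (S : Finset ι) (c : ι → ℝ) :
    ‖∑ i ∈ S, c i • D.basis i‖ ^ 2 = ∑ i ∈ S, c i ^ 2 := by
  rw [norm_sum_smul_sq_of_orthogonal (fun i j h => D.basis.orthonormal.2 h)]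
  simp [D.basis.orthonormal.1]

/-- Cauchy criterion. It covers orthogonal series, which need not converge absolutely. -/
lemma summable_of_norm_sum_sq_le {E : Type*} [NormedAddCommGroup E] [CompleteSpace E]
    {f : ι → E} {a : ι → ℝ} (ha : Summable a)
    (h : ∀ S : Finset ι, ‖∑ i ∈ S, f i‖ ^ 2 ≤ ∑ i ∈ S, a i) : Summable f := by
  rw [summable_iff_vanishing_norm]
  intro ε hε
  obtain ⟨s, hs⟩ := summable_iff_vanishing_norm.1 ha (ε ^ 2) (by positivity)
  refine ⟨s, fun t ht => ?_⟩
  exact lt_of_pow_lt_pow_left₀ 2 hε.le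
    ((h t).trans_lt ((le_abs_self _).trans_lt (hs t ht)))

lemma summable_smul_grad [CompleteSpace V] {c : ι → ℝ}
    (hc : Summable fun i => D.eig i * c i ^ 2) : Summable fun i => c i • D.grad i :=
  summable_of_norm_sum_sq_le hc fun S => (D.norm_sum_smul_grad_sq S c).le

lemma hasSum_norm_sq {c : ι → ℝ} {z : V} (h : HasSum (fun i => c i • D.grad i) z) :
    HasSum (fun i => D.eig i * c i ^ 2) (‖z‖ ^ 2) := by
  have := (Filter.Tendsto.norm h).pow 2
  simpa only [HasSum, norm_sum_smul_grad_sq] using this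

lemma mem_of_hasSum {c : ι → ℝ} {x : H} {z : V} (hx : HasSum (fun i => c i • D.basis i) x)
    (hz : HasSum (fun i => c i • D.grad i) z) : (x, z) ∈ D.graph := by
  refine D.isClosed_graph.mem_of_tendsto (Filter.Tendsto.prodMk_nhds hx hz)
    (Eventually.of_forall fun S => ?_)
  have : (∑ i ∈ S, c i • D.basis i, ∑ i ∈ S, c i • D.grad i) =
      ∑ i ∈ S, c i • (D.basis i, D.grad i) := by
    ext <;> simp [Prod.fst_sum, Prod.snd_sum]
  rw [this]
  exact D.graph.sum_mem fun i _ => D.graph.smul_mem _ (D.basis_mem i)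

lemma hasSum_basis (x : H) : HasSum (fun i => inner ℝ x (D.basis i) • D.basis i) x := by
  have := D.basis.hasSum_repr x
  simpa only [D.basis.repr_apply_apply, real_inner_comm] using this

/-- Termwise differentiation: Bessel makes the differentiated series converge, closedness of the
graph makes its sum a gradient of `v`, and gradients are unique. -/
lemma hasSum_grad [CompleteSpace V] {v : H} {w : V} (h : (v, w) ∈ D.graph) :
    HasSum (fun i => inner ℝ v (D.basis i) • D.grad i) w := by
  have hb : ∀ i, D.eig i * inner ℝ v (D.basis i) ^ 2 ≤ inner ℝ w (D.unitGrad i) ^ 2 := by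
    intro i
    have h1 := D.inner_grad v w h i
    have h2 := Real.mul_self_sqrt (D.eig_nonneg i)
    rcases eq_or_ne (D.eig i) 0 with h0 | h0
    · rw [h0, zero_mul]; positivity
    · have h3 : √(D.eig i) ≠ 0 := (Real.sqrt_pos.2 ((D.eig_nonneg i).lt_of_ne' h0)).ne'
      have h4 : inner ℝ w (D.unitGrad i) = √(D.eig i) * inner ℝ v (D.basis i) := by
        apply mul_left_cancel₀ h3
        rw [← mul_assoc, h2, ← h1]
        conv_rhs => rw [D.grad_eq, inner_smul_right]
      rw [h4, mul_pow, sq √(D.eig i), h2]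
  have hs : Summable fun i => D.eig i * inner ℝ v (D.basis i) ^ 2 :=
    summable_of_sum_le (fun i => mul_nonneg (D.eig_nonneg i) (sq_nonneg _)) fun S =>
      (Finset.sum_le_sum fun i _ => hb i).trans (D.sum_inner_unitGrad_sq_le S w)
  obtain ⟨z, hz⟩ := D.summable_smul_grad hs
  have hm := D.graph.sub_mem h (D.mem_of_hasSum (D.hasSum_basis v) hz)
  rw [Prod.mk_sub_mk, sub_self] at hm
  rwa [sub_eq_zero.1 (D.eq_zero _ hm)]

/-- An identity `⟨a, v⟩ = ⟨c, ∇v⟩` has to be checked on the basis vectors only. -/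
lemma inner_eq_of_basis [CompleteSpace V] {a : H} {c : V}
    (hac : ∀ i, inner ℝ a (D.basis i) = inner ℝ c (D.grad i)) {v : H} {w : V}
    (h : (v, w) ∈ D.graph) : inner ℝ a v = inner ℝ c w := by
  have h1 := (D.hasSum_basis v).mapL (innerSL ℝ a)
  have h2 := (D.hasSum_grad h).mapL (innerSL ℝ c)
  simp only [map_smul, innerSL_apply_apply, hac] at h1 h2
  exact h1.unique h2

lemma hasSum_inner_basis_sq (x : H) : HasSum (fun i => inner ℝ x (D.basis i) ^ 2) (‖x‖ ^ 2) := by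
  have := D.basis.hasSum_inner_mul_inner x x
  simpa only [real_inner_comm x, ← sq, real_inner_self_eq_norm_sq] using this

end SpectralGradient

/-! ### Scalar mode equations and Gronwall's inequality. -/

/-- The energy estimate for one mode. -/
lemma scalar_energy_le {l a T : ℝ} (hl : 0 ≤ l) {u γ : ℝ → ℝ} (hu : Continuous u)
    (hγ : Continuous γ)
    (h : ∀ t ∈ Icc 0 T, u t = a + ∫ s in (0 : ℝ)..t, (-(1 / 2) * (l * u s) + √l * γ s))
    {t : ℝ} (ht : t ∈ Icc 0 T) :
    u t ^ 2 + l / 2 * ∫ s in (0 : ℝ)..t, u s ^ 2 ≤ a ^ 2 + 2 * ∫ s in (0 : ℝ)..t, γ s ^ 2 := by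
  have hc : Continuous fun s => -(1 / 2) * (l * u s) + √l * γ s := by fun_prop
  -- `U` agrees with `u` on `[0, T]` but is differentiable on the whole line.
  set U : ℝ → ℝ := fun t => a + ∫ s in (0 : ℝ)..t, (-(1 / 2) * (l * u s) + √l * γ s) with hU
  have hdU : ∀ t, HasDerivAt U (-(1 / 2) * (l * u t) + √l * γ t) t := fun t =>
    (hc.integral_hasStrictDerivAt 0 t).hasDerivAt.const_add a
  have hd : ∀ t, HasDerivAt
      (fun t => 2 * (∫ s in (0 : ℝ)..t, γ s ^ 2) - l / 2 * (∫ s in (0 : ℝ)..t, u s ^ 2) - U t ^ 2)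
      (2 * γ t ^ 2 - l / 2 * u t ^ 2 - (2 * U t ^ 1 * (-(1 / 2) * (l * u t) + √l * γ t))) t := by
    intro t
    have h1 := ((hγ.pow 2).integral_hasStrictDerivAt 0 t).hasDerivAt.const_mul 2
    have h2 := ((hu.pow 2).integral_hasStrictDerivAt 0 t).hasDerivAt.const_mul (l / 2)
    simpa using! (h1.sub h2).sub ((hdU t).pow 2)
  have hmono : MonotoneOn (fun t => 2 * (∫ s in (0 : ℝ)..t, γ s ^ 2) -
      l / 2 * (∫ s in (0 : ℝ)..t, u s ^ 2) - U t ^ 2) (Icc 0 T) := by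
    refine monotoneOn_of_deriv_nonneg (convex_Icc 0 T)
      (fun x _ => (hd x).continuousAt.continuousWithinAt)
      (fun x _ => (hd x).differentiableAt.differentiableWithinAt) fun x hx => ?_
    rw [interior_Icc] at hx
    rw [(hd x).deriv, show U x = u x from (h x ⟨hx.1.le, hx.2.le⟩).symm]
    -- The derivative is exactly `½(√l u - 2γ)²`.
    nlinarith [sq_nonneg (√l * u x - 2 * γ x), Real.sq_sqrt hl]
  have h0 : (0 : ℝ) ∈ Icc 0 T := ⟨le_rfl, ht.1.trans ht.2⟩
  have h1 := hmono h0 ht ht.1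
  have h2 : U t = u t := (h t ht).symm
  simp only [intervalIntegral.integral_same, hU] at h1
  simp only [hU] at h2
  rw [h2] at h1
  linarith

/-- The mode equation has a solution. -/
lemma exists_scalar_solution (l a : ℝ) {h : ℝ → ℝ} (hh : Continuous h) :
    ∃ u : ℝ → ℝ, Continuous u ∧
      ∀ t, u t = a + ∫ s in (0 : ℝ)..t, (-(1 / 2) * (l * u s) + h s) := by
  -- Variation of constants.
  set u : ℝ → ℝ := fun t => Real.exp (-(l / 2) * t) *
    (a + ∫ s in (0 : ℝ)..t, Real.exp (l / 2 * s) * h s) with hu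
  have hc : Continuous fun s => Real.exp (l / 2 * s) * h s := by fun_prop
  have hd : ∀ t, HasDerivAt u (-(1 / 2) * (l * u t) + h t) t := by
    intro t
    have h1 : HasDerivAt (fun t : ℝ => Real.exp (-(l / 2) * t))
        (Real.exp (-(l / 2) * t) * (-(l / 2) * 1)) t :=
      ((hasDerivAt_id t).const_mul _).exp
    have h2 := h1.mul ((hc.integral_hasStrictDerivAt 0 t).hasDerivAt.const_add a)
    convert! h2 using 1
    have h3 : Real.exp (-(l / 2) * t) * Real.exp (l / 2 * t) = 1 := by
      rw [← Real.exp_add]; simp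
    simp only [hu]
    linear_combination (-h t) * h3
  have hcu : Continuous u := continuous_iff_continuousAt.2 fun t => (hd t).continuousAt
  refine ⟨u, hcu, fun t => ?_⟩
  rw [intervalIntegral.integral_eq_sub_of_hasDerivAt (fun x _ => hd x)
    (Continuous.intervalIntegrable (by fun_prop) _ _)]
  simp [hu]

/-- Gronwall's inequality in integral form. -/
lemma le_mul_exp_of_le_integral {y : ℝ → ℝ} {A B T : ℝ} (hB : 0 ≤ B) (hy : Continuous y)
    (h : ∀ t ∈ Icc 0 T, y t ≤ A + B * ∫ s in (0 : ℝ)..t, y s) {t : ℝ} (ht : t ∈ Icc 0 T) :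
    y t ≤ A * Real.exp (B * t) := by
  have hd : ∀ t, HasDerivAt (fun t => Real.exp (-B * t) * (A + B * ∫ s in (0 : ℝ)..t, y s))
      (Real.exp (-B * t) * (-B * 1) * (A + B * ∫ s in (0 : ℝ)..t, y s) +
        Real.exp (-B * t) * (B * y t)) t := fun t =>
    ((hasDerivAt_id t).const_mul (-B)).exp.mul
      (((hy.integral_hasStrictDerivAt 0 t).hasDerivAt.const_mul B).const_add A)
  have hanti : AntitoneOn (fun t => Real.exp (-B * t) * (A + B * ∫ s in (0 : ℝ)..t, y s))
      (Icc 0 T) := by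
    refine antitoneOn_of_deriv_nonpos (convex_Icc 0 T)
      (fun x _ => (hd x).continuousAt.continuousWithinAt)
      (fun x _ => (hd x).differentiableAt.differentiableWithinAt) fun x hx => ?_
    rw [interior_Icc] at hx
    rw [(hd x).deriv]
    have := mul_le_mul_of_nonneg_left (h x ⟨hx.1.le, hx.2.le⟩)
      (mul_nonneg hB (Real.exp_pos (-B * x)).le)
    linarith
  have h0 : (0 : ℝ) ∈ Icc 0 T := ⟨le_rfl, ht.1.trans ht.2⟩
  have h1 := hanti h0 ht ht.1
  simp only [mul_zero, Real.exp_zero, intervalIntegral.integral_same, add_zero, one_mul] at h1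
  have h2 := mul_le_mul_of_nonneg_right h1 (Real.exp_pos (B * t)).le
  have h3 : Real.exp (-B * t) * Real.exp (B * t) = 1 := by
    rw [← Real.exp_add]; simp
  calc y t ≤ A + B * ∫ s in (0 : ℝ)..t, y s := h t ht
    _ = Real.exp (-B * t) * (A + B * ∫ s in (0 : ℝ)..t, y s) * Real.exp (B * t) := by
        linear_combination (-(A + B * ∫ s in (0 : ℝ)..t, y s)) * h3
    _ ≤ _ := h2

end

/-! ### Variational solutions without drift. -/

noncomputable section

namespace SpectralGradient

open Filter Topology

variable {ι H V : Type*} [NormedAddCommGroup H] [InnerProductSpace ℝ H]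
    [NormedAddCommGroup V] [InnerProductSpace ℝ V] (D : SpectralGradient ι H V)

/-- `u` is a variational solution of `∂ₜ u = ½ Δ u - div g`, `u(0) = u₀`, on `[0, T]`. -/
def IsSolution (T : ℝ) (g : ℝ → V) (u₀ : H) (u : ℝ → H) : Prop :=
  ContinuousOn u (Icc 0 T) ∧ u 0 = u₀ ∧
    ∃ G : ℝ → V, MemLp G 2 (volume.restrict (Ioc 0 T)) ∧
      (∀ᵐ t ∂(volume.restrict (Ioc 0 T)), (u t, G t) ∈ D.graph) ∧
      ∀ (v : H) (w : V), (v, w) ∈ D.graph → ∀ t ∈ Icc 0 T,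
        inner ℝ (u t) v = inner ℝ u₀ v +
          ∫ s in (0 : ℝ)..t, (-(1 / 2) * inner ℝ (G s) w + inner ℝ (g s) w)

variable {D} {T : ℝ} {g g₁ g₂ : ℝ → V} {u₀ u₁ u₂ : H} {u v : ℝ → H}

/-- Extending by the endpoint values gives functions continuous on the whole line, so that calculus
needs no care at the endpoints. -/
lemma continuous_IccExtend {E : Type*} [TopologicalSpace E] (hT : 0 ≤ T) {f : ℝ → E}
    (hf : ContinuousOn f (Icc 0 T)) : Continuous (IccExtend hT (fun x : Icc 0 T => f x)) :=
  (continuousOn_iff_continuous_domRestrict.1 hf).Icc_extend'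

lemma IccExtend_eq {E : Type*} (hT : 0 ≤ T) (f : ℝ → E) {t : ℝ} (ht : t ∈ Icc 0 T) :
    IccExtend hT (fun x : Icc 0 T => f x) t = f t :=
  IccExtend_of_mem hT _ ht

lemma IsSolution.congr (h : D.IsSolution T g u₀ u) (hT : 0 ≤ T) (hg : EqOn g₁ g (Icc 0 T))
    (hv : EqOn v u (Icc 0 T)) : D.IsSolution T g₁ u₀ v := by
  obtain ⟨hc, h0, G, hG, hD, he⟩ := h
  refine ⟨hc.congr hv, by rw [hv ⟨le_rfl, hT⟩, h0], G, hG, ?_, fun x w hxw t ht => ?_⟩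
  · filter_upwards [hD, ae_restrict_mem measurableSet_Ioc] with t h1 h2
    rwa [hv ⟨h2.1.le, h2.2⟩]
  · rw [hv ht, he x w hxw t ht]
    congr 1
    refine intervalIntegral.integral_congr fun s hs => ?_
    rw [uIcc_of_le ht.1] at hs
    simp only [hg ⟨hs.1, hs.2.trans ht.2⟩]

lemma intervalIntegrable_inner {G : ℝ → V} (hG : MemLp G 2 (volume.restrict (Ioc 0 T)))
    (w : V) {t : ℝ} (ht : t ∈ Icc 0 T) :
    IntervalIntegrable (fun s => inner ℝ (G s) w) volume 0 t := by
  rw [intervalIntegrable_iff_integrableOn_Ioc_of_le ht.1]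
  exact IntegrableOn.mono_set ((hG.integrable (by norm_num)).inner_const w)
    (Ioc_subset_Ioc_right ht.2)

lemma intervalIntegrable_inner_of_continuousOn {f : ℝ → V} (hf : ContinuousOn f (Icc 0 T))
    (w : V) {t : ℝ} (ht : t ∈ Icc 0 T) :
    IntervalIntegrable (fun s => inner ℝ (f s) w) volume 0 t := by
  refine ContinuousOn.intervalIntegrable ?_
  rw [uIcc_of_le ht.1]
  exact (hf.mono (Icc_subset_Icc_right ht.2)).inner continuousOn_const

lemma IsSolution.add_smul (h₁ : D.IsSolution T g₁ u₁ u) (h₂ : D.IsSolution T g₂ u₂ v)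
    (hg₁ : ContinuousOn g₁ (Icc 0 T)) (hg₂ : ContinuousOn g₂ (Icc 0 T)) (c : ℝ) :
    D.IsSolution T (fun t => g₁ t + c • g₂ t) (u₁ + c • u₂) (fun t => u t + c • v t) := by
  obtain ⟨hc₁, h0₁, G₁, hG₁, hD₁, he₁⟩ := h₁
  obtain ⟨hc₂, h0₂, G₂, hG₂, hD₂, he₂⟩ := h₂
  refine ⟨hc₁.add (hc₂.const_smul c), by simp only [h0₁, h0₂], fun t => G₁ t + c • G₂ t,
    hG₁.add (hG₂.const_smul c), ?_, fun x w hxw t ht => ?_⟩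
  · filter_upwards [hD₁, hD₂] with t h1 h2
    exact D.graph.add_mem h1 (D.graph.smul_mem c h2)
  · have i₁ := ((intervalIntegrable_inner hG₁ w ht).const_mul (-(1 / 2))).add
      (intervalIntegrable_inner_of_continuousOn hg₁ w ht)
    have i₂ := ((intervalIntegrable_inner hG₂ w ht).const_mul (-(1 / 2))).add
      (intervalIntegrable_inner_of_continuousOn hg₂ w ht)
    have hsum := intervalIntegral.integral_add i₁ (i₂.const_mul c)
    rw [intervalIntegral.integral_const_mul] at hsum
    simp only [inner_add_left, inner_smul_left, conj_trivial]
    rw [he₁ x w hxw t ht, he₂ x w hxw t ht]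
    have hcongr : (∫ s in (0 : ℝ)..t, (-(1 / 2) * (inner ℝ (G₁ s) w + c * inner ℝ (G₂ s) w) +
        (inner ℝ (g₁ s) w + c * inner ℝ (g₂ s) w))) =
        ∫ s in (0 : ℝ)..t, ((-(1 / 2) * inner ℝ (G₁ s) w + inner ℝ (g₁ s) w) +
          c * (-(1 / 2) * inner ℝ (G₂ s) w + inner ℝ (g₂ s) w)) :=
      intervalIntegral.integral_congr fun s _ => by ring
    rw [hcongr]
    refine Eq.trans ?_ (congrArg _ hsum.symm)
    ring

/-- The energy estimate. -/
lemma IsSolution.norm_sq_le (h : D.IsSolution T g u₀ u) (hg : ContinuousOn g (Icc 0 T))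
    {t : ℝ} (ht : t ∈ Icc 0 T) :
    ‖u t‖ ^ 2 ≤ ‖u₀‖ ^ 2 + 2 * ∫ s in (0 : ℝ)..t, ‖g s‖ ^ 2 := by
  have hT : 0 ≤ T := ht.1.trans ht.2
  obtain ⟨hc, h0, G, hG, hD, he⟩ := h
  set u' := IccExtend hT (fun x : Icc 0 T => u x) with hu'
  set g' := IccExtend hT (fun x : Icc 0 T => g x) with hg'
  have cu : Continuous u' := continuous_IccExtend hT hc
  have cg : Continuous g' := continuous_IccExtend hT hg
  -- Testing with `basis i` gives the scalar equation of `scalar_energy_le`, with `γ = ⟨g, unitGrad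
  -- i⟩`; the dissipation integral is then dropped.
  have mode : ∀ i, inner ℝ (u t) (D.basis i) ^ 2 ≤ inner ℝ u₀ (D.basis i) ^ 2 +
      2 * ∫ s in (0 : ℝ)..t, inner ℝ (g' s) (D.unitGrad i) ^ 2 := by
    intro i
    have key : ∀ r ∈ Icc 0 T, inner ℝ (u' r) (D.basis i) = inner ℝ u₀ (D.basis i) +
        ∫ s in (0 : ℝ)..r, (-(1 / 2) * (D.eig i * inner ℝ (u' s) (D.basis i)) +
          √(D.eig i) * inner ℝ (g' s) (D.unitGrad i)) := by
      intro r hr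
      rw [hu', IccExtend_eq hT u hr, he _ _ (D.basis_mem i) r hr]
      congr 1
      refine intervalIntegral.integral_congr_ae ?_
      rw [ae_restrict_iff' measurableSet_Ioc] at hD
      filter_upwards [hD] with s hs hsr
      rw [uIoc_of_le hr.1] at hsr
      have hsT : s ∈ Ioc 0 T := ⟨hsr.1, hsr.2.trans hr.2⟩
      rw [D.inner_grad _ _ (hs hsT) i, IccExtend_eq hT u (Ioc_subset_Icc_self hsT), hg',
        IccExtend_eq hT g (Ioc_subset_Icc_self hsT), D.inner_grad_right]
    have := scalar_energy_le (D.eig_nonneg i) (cu.inner continuous_const)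
      (cg.inner continuous_const) key ht
    rw [hu', IccExtend_eq hT u ht, ← hu'] at this
    have hn : 0 ≤ D.eig i / 2 * ∫ s in (0 : ℝ)..t, inner ℝ (u' s) (D.basis i) ^ 2 :=
      mul_nonneg (by linarith [D.eig_nonneg i])
        (intervalIntegral.integral_nonneg ht.1 fun s _ => sq_nonneg _)
    linarith
  refine hasSum_le_of_sum_le (D.hasSum_inner_basis_sq (u t)) fun S => ?_
  have hint : ∀ i, IntervalIntegrable (fun s => inner ℝ (g' s) (D.unitGrad i) ^ 2) volume 0 t :=
    fun i => ((cg.inner continuous_const).pow 2).intervalIntegrable _ _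
  calc ∑ i ∈ S, inner ℝ (u t) (D.basis i) ^ 2
      ≤ ∑ i ∈ S, (inner ℝ u₀ (D.basis i) ^ 2 +
          2 * ∫ s in (0 : ℝ)..t, inner ℝ (g' s) (D.unitGrad i) ^ 2) :=
        Finset.sum_le_sum fun i _ => mode i
    _ = ∑ i ∈ S, inner ℝ u₀ (D.basis i) ^ 2 +
          2 * ∫ s in (0 : ℝ)..t, ∑ i ∈ S, inner ℝ (g' s) (D.unitGrad i) ^ 2 := by
        rw [Finset.sum_add_distrib, ← Finset.mul_sum,
          intervalIntegral.integral_finsetSum fun i _ => hint i]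
    _ ≤ ‖u₀‖ ^ 2 + 2 * ∫ s in (0 : ℝ)..t, ‖g' s‖ ^ 2 := by
        gcongr
        · exact sum_le_hasSum _ (fun i _ => sq_nonneg _) (D.hasSum_inner_basis_sq u₀)
        · refine intervalIntegral.integral_mono_on ht.1
            (Continuous.intervalIntegrable (by fun_prop) _ _)
            ((cg.norm.pow 2).intervalIntegrable _ _) fun s _ => D.sum_inner_unitGrad_sq_le S _
    _ = _ := by
        congr 2
        refine intervalIntegral.integral_congr fun s hs => ?_
        rw [uIcc_of_le ht.1] at hs
        simp only [hg', IccExtend_eq hT g ⟨hs.1, hs.2.trans ht.2⟩]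

/-- The linear problem with a continuous right-hand side has a solution. -/
theorem exists_isSolution [Countable ι] [CompleteSpace H] [CompleteSpace V] (hT : 0 ≤ T)
    (hg : Continuous g) (u₀ : H) :
    ∃ u, D.IsSolution T g u₀ u := by
  have hex : ∀ i, ∃ c : ℝ → ℝ, Continuous c ∧ ∀ t, c t = inner ℝ u₀ (D.basis i) +
      ∫ s in (0 : ℝ)..t, (-(1 / 2) * (D.eig i * c s) + inner ℝ (g s) (D.grad i)) := fun i =>
    exists_scalar_solution _ _ (hg.inner continuous_const)
  choose c hc hceq using hex
  -- A summable majorant, uniform in `t`, of the energy of each mode.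
  set a : ι → ℝ := fun i => inner ℝ u₀ (D.basis i) ^ 2 +
    2 * ∫ s in (0 : ℝ)..T, inner ℝ (g s) (D.unitGrad i) ^ 2 with ha
  have hγ : ∀ i, Continuous fun s => inner ℝ (g s) (D.unitGrad i) ^ 2 := fun i =>
    (hg.inner continuous_const).pow 2
  have henergy : ∀ i, ∀ t ∈ Icc 0 T,
      c i t ^ 2 + D.eig i / 2 * ∫ s in (0 : ℝ)..t, c i s ^ 2 ≤ a i := by
    intro i t ht
    refine (scalar_energy_le (D.eig_nonneg i) (hc i)
      (hg.inner continuous_const) (a := inner ℝ u₀ (D.basis i))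
      (γ := fun s => inner ℝ (g s) (D.unitGrad i)) (fun t _ => ?_) ht).trans ?_
    · rw [hceq i t]
      simp only [D.inner_grad_right]
    · simp only [ha]
      gcongr
      rw [← intervalIntegral.integral_add_adjacent_intervals
        ((hγ i).intervalIntegrable 0 t) ((hγ i).intervalIntegrable t T)]
      exact le_add_of_nonneg_right
        (intervalIntegral.integral_nonneg ht.2 fun s _ => sq_nonneg _)
  have ha0 : ∀ i, 0 ≤ a i := fun i => add_nonneg (sq_nonneg _)
    (mul_nonneg zero_le_two (intervalIntegral.integral_nonneg hT fun s _ => sq_nonneg _))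
  have hasum : Summable a := by
    refine (D.hasSum_inner_basis_sq u₀).summable.add (Summable.mul_left 2 ?_)
    refine summable_of_sum_le (c := ∫ s in (0 : ℝ)..T, ‖g s‖ ^ 2)
      (fun i => intervalIntegral.integral_nonneg hT fun s _ => sq_nonneg _) fun S => ?_
    rw [← intervalIntegral.integral_finsetSum fun i _ => (hγ i).intervalIntegrable _ _]
    exact intervalIntegral.integral_mono_on hT
      (Continuous.intervalIntegrable (by fun_prop) _ _)
      ((hg.norm.pow 2).intervalIntegrable _ _) fun s _ => D.sum_inner_unitGrad_sq_le S _
  have hcle : ∀ i, ∀ t ∈ Icc 0 T, c i t ^ 2 ≤ a i := fun i t ht => by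
    have h1 := henergy i t ht
    have h2 : 0 ≤ D.eig i / 2 * ∫ s in (0 : ℝ)..t, c i s ^ 2 :=
      mul_nonneg (by linarith [D.eig_nonneg i])
        (intervalIntegral.integral_nonneg ht.1 fun s _ => sq_nonneg _)
    linarith
  -- the solution as a uniformly convergent series
  set f : ι → C(Icc (0 : ℝ) T, H) := fun i =>
    ⟨fun t => c i t • D.basis i, by have := hc i; fun_prop⟩ with hf
  have hfsum : Summable f := by
    refine summable_of_norm_sum_sq_le hasum fun S => ?_
    have hS : 0 ≤ ∑ i ∈ S, a i := Finset.sum_nonneg fun i _ => ha0 i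
    refine (Real.le_sqrt (norm_nonneg _) hS).1 ?_
    rw [ContinuousMap.norm_le _ (Real.sqrt_nonneg _)]
    intro x
    refine Real.le_sqrt_of_sq_le ?_
    simp only [ContinuousMap.coe_sum, Finset.sum_apply, hf, ContinuousMap.coe_mk]
    rw [D.norm_sum_smul_basis_sq S fun i => c i x]
    exact Finset.sum_le_sum fun i _ => hcle i x x.2
  obtain ⟨U, hU⟩ := hfsum
  set u : ℝ → H := IccExtend hT U with hu
  have hut : ∀ t ∈ Icc 0 T, HasSum (fun i => c i t • D.basis i) (u t) := by
    intro t ht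
    have := (ContinuousMap.evalCLM ℝ (⟨t, ht⟩ : Icc (0 : ℝ) T)).hasSum hU
    simpa [hf, hu, IccExtend_of_mem hT U ht] using! this
  have hcoef : ∀ t ∈ Icc 0 T, ∀ i, inner ℝ (u t) (D.basis i) = c i t := by
    classical
    intro t ht i
    have h1 := (hut t ht).mapL (innerSL ℝ (D.basis i))
    have h2 : HasSum (fun j => (innerSL ℝ (D.basis i)) (c j t • D.basis j)) (c i t) := by
      convert! hasSum_ite_eq i (c i t) using 2 with j
      rw [innerSL_apply_apply, inner_smul_right, orthonormal_iff_ite.1 D.basis.orthonormal]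
      by_cases hij : j = i <;> simp [hij, Ne.symm]
    rw [real_inner_comm]
    exact h1.unique h2
  have hu0 : u 0 = u₀ := by
    have h0 := hut 0 ⟨le_rfl, hT⟩
    have h1 := D.hasSum_basis u₀
    have h2 : ∀ i, c i 0 = inner ℝ u₀ (D.basis i) := fun i => by rw [hceq]; simp
    simp only [h2] at h0
    exact h0.unique h1
  -- its gradient
  have hlin : ∫⁻ t in Ioc 0 T, ∑' i, ENNReal.ofReal (D.eig i * c i t ^ 2) < ⊤ := by
    rw [lintegral_tsum fun i => by have := hc i; fun_prop]
    have hle : ∀ i, ∫⁻ t in Ioc 0 T, ENNReal.ofReal (D.eig i * c i t ^ 2) ≤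
        ENNReal.ofReal (2 * a i) := by
      intro i
      have hci : Continuous fun t => D.eig i * c i t ^ 2 := by have := hc i; fun_prop
      rw [← ofReal_integral_eq_lintegral_ofReal (hci.integrableOn_Ioc)
        (Eventually.of_forall fun t => mul_nonneg (D.eig_nonneg i) (sq_nonneg _)),
        ← intervalIntegral.integral_of_le hT, intervalIntegral.integral_const_mul]
      have := henergy i T ⟨hT, le_rfl⟩
      exact ENNReal.ofReal_le_ofReal (by nlinarith [sq_nonneg (c i T)])
    refine (ENNReal.tsum_le_tsum hle).trans_lt ?_
    rw [← ENNReal.ofReal_tsum_of_nonneg (fun i => mul_nonneg zero_le_two (ha0 i))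
      (hasum.mul_left 2)]
    exact ENNReal.ofReal_lt_top
  have hae : ∀ᵐ t ∂(volume.restrict (Ioc 0 T)), Summable fun i => D.eig i * c i t ^ 2 := by
    have := ae_lt_top' (AEMeasurable.tsum
      (f := fun i t => ENNReal.ofReal (D.eig i * c i t ^ 2)) fun i => by
      have := hc i; fun_prop) hlin.ne
    filter_upwards [this] with t ht
    have h1 := ENNReal.summable_toReal ht.ne
    simpa only [ENNReal.toReal_ofReal (mul_nonneg (D.eig_nonneg _) (sq_nonneg _))] using h1
  set G : ℝ → V := fun t => ∑' i, c i t • D.grad i with hG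
  have hGsum : ∀ᵐ t ∂(volume.restrict (Ioc 0 T)), HasSum (fun i => c i t • D.grad i) (G t) := by
    filter_upwards [hae] with t ht
    exact (D.summable_smul_grad ht).hasSum
  have hGmeas : AEStronglyMeasurable G (volume.restrict (Ioc 0 T)) := by
    refine aestronglyMeasurable_of_tendsto_ae (u := (atTop : Filter (Finset ι)))
      (f := fun S t => ∑ i ∈ S, c i t • D.grad i) (fun S => ?_) hGsum
    exact Continuous.aestronglyMeasurable (by fun_prop)
  have hGL : MemLp G 2 (volume.restrict (Ioc 0 T)) := by
    rw [memLp_two_iff_integrable_sq_norm hGmeas]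
    refine ⟨hGmeas.norm.pow 2, ?_⟩
    rw [hasFiniteIntegral_iff_ofReal (Eventually.of_forall fun t => sq_nonneg _)]
    refine lt_of_eq_of_lt (lintegral_congr_ae ?_) hlin
    filter_upwards [hGsum] with t ht
    have h1 := D.hasSum_norm_sq ht
    rw [← h1.tsum_eq, ENNReal.ofReal_tsum_of_nonneg
      (fun i => mul_nonneg (D.eig_nonneg _) (sq_nonneg _)) h1.summable]
  have hmem : ∀ᵐ t ∂(volume.restrict (Ioc 0 T)), (u t, G t) ∈ D.graph := by
    filter_upwards [hGsum, ae_restrict_mem measurableSet_Ioc] with t h1 h2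
    exact D.mem_of_hasSum (hut t (Ioc_subset_Icc_self h2)) h1
  refine ⟨u, (U.continuous.Icc_extend').continuousOn, hu0, G, hGL, hmem, fun v w hvw t ht => ?_⟩
  have hGi : IntervalIntegrable G volume 0 t := by
    rw [intervalIntegrable_iff_integrableOn_Ioc_of_le ht.1]
    exact IntegrableOn.mono_set (hGL.integrable (by norm_num)) (Ioc_subset_Ioc_right ht.2)
  have hI : IntervalIntegrable (fun s => (-(1 / 2) : ℝ) • G s + g s) volume 0 t :=
    (hGi.smul (-(1 / 2) : ℝ)).add (hg.intervalIntegrable _ _)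
  -- Moving the test vector out of the time integral gives the equation the form `⟨a, v⟩ = ⟨c, w⟩`,
  -- to be checked on basis vectors only.
  have hw : ∀ w, ∫ s in (0 : ℝ)..t, (-(1 / 2) * inner ℝ (G s) w + inner ℝ (g s) w) =
      inner ℝ (∫ s in (0 : ℝ)..t, ((-(1 / 2) : ℝ) • G s + g s)) w := by
    intro w
    have := (innerSL ℝ w).intervalIntegral_comp_comm hI
    rw [real_inner_comm, ← innerSL_apply_apply, ← this]
    refine intervalIntegral.integral_congr fun s _ => ?_
    simp only [innerSL_apply_apply, inner_add_right, inner_smul_right, real_inner_comm w]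
  rw [hw, ← sub_eq_iff_eq_add', ← inner_sub_left]
  refine D.inner_eq_of_basis (fun i => ?_) hvw
  rw [inner_sub_left, hcoef t ht i, ← hw, hceq i t, add_sub_cancel_left]
  refine intervalIntegral.integral_congr_ae ?_
  rw [ae_restrict_iff' measurableSet_Ioc] at hmem
  filter_upwards [hmem] with s hs hst
  rw [uIoc_of_le ht.1] at hst
  have hsT : s ∈ Ioc 0 T := ⟨hst.1, hst.2.trans ht.2⟩
  rw [D.inner_grad _ _ (hs hsT) i, hcoef s (Ioc_subset_Icc_self hsT) i]

end SpectralGradient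

end

/-! ### Bounded drift: estimate, uniqueness, existence. -/

noncomputable section

namespace SpectralGradient

open Filter Topology

variable {ι H V : Type*} [NormedAddCommGroup H] [InnerProductSpace ℝ H]
    [NormedAddCommGroup V] [InnerProductSpace ℝ V] {D : SpectralGradient ι H V}
    {T : ℝ} {F F₁ F₂ : ℝ → V} {u₀ u₁ u₂ : H} {u v : ℝ → H} {B : H →L[ℝ] V}

lemma continuousOn_drift (hu : ContinuousOn u (Icc 0 T)) (hF : ContinuousOn F (Icc 0 T)) :
    ContinuousOn (fun t => B (u t) + F t) (Icc 0 T) :=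
  (B.continuous.comp_continuousOn hu).add hF

/-- The energy estimate in the presence of a bounded drift. -/
lemma IsSolution.drift_norm_sq_le (h : D.IsSolution T (fun t => B (u t) + F t) u₀ u)
    (hF : ContinuousOn F (Icc 0 T)) {M C : ℝ} (hB : ‖B‖ ≤ M)
    (hC : ∀ t ∈ Icc 0 T, ‖F t‖ ≤ C) {t : ℝ} (ht : t ∈ Icc 0 T) :
    ‖u t‖ ^ 2 ≤ (‖u₀‖ ^ 2 + 4 * C ^ 2 * t) * Real.exp (4 * M ^ 2 * t) := by
  have hT : 0 ≤ T := ht.1.trans ht.2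
  set u' := IccExtend hT (fun x : Icc 0 T => u x) with hu'
  have cu : Continuous u' := continuous_IccExtend hT h.1
  rw [← IccExtend_eq hT u ht, ← hu']
  -- The horizon is `t` itself, so that `4 * C ^ 2 * r ≤ 4 * C ^ 2 * t` serves as the constant and
  -- the final bound keeps the factor `t`. The 4 is the 2 of the energy estimate times the 2 of `(x
  -- + y)² ≤ 2x² + 2y²`.
  refine le_mul_exp_of_le_integral (T := t) (y := fun t => ‖u' t‖ ^ 2) (by positivity)
    (cu.norm.pow 2) (fun r hr => ?_) ⟨ht.1, le_rfl⟩
  have hrT : r ∈ Icc 0 T := ⟨hr.1, hr.2.trans ht.2⟩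
  have hcont := (continuousOn_drift (B := B) h.1 hF).mono (Icc_subset_Icc_right hrT.2)
  have h1 := h.norm_sq_le (continuousOn_drift h.1 hF) hrT
  have h2 : ∫ s in (0 : ℝ)..r, ‖B (u s) + F s‖ ^ 2 ≤
      ∫ s in (0 : ℝ)..r, (2 * M ^ 2 * ‖u' s‖ ^ 2 + 2 * C ^ 2) := by
    refine intervalIntegral.integral_mono_on hr.1 ?_
      (Continuous.intervalIntegrable (by fun_prop) _ _) fun s hs => ?_
    · refine ContinuousOn.intervalIntegrable ?_
      rw [uIcc_of_le hr.1]
      exact hcont.norm.pow 2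
    · have hsT : s ∈ Icc 0 T := ⟨hs.1, hs.2.trans hrT.2⟩
      rw [hu', IccExtend_eq hT u hsT]
      have e1 : ‖B (u s) + F s‖ ≤ M * ‖u s‖ + C :=
        (norm_add_le _ _).trans (add_le_add (B.le_of_opNorm_le hB _) (hC s hsT))
      have e2 := pow_le_pow_left₀ (norm_nonneg _) e1 2
      nlinarith [sq_nonneg (M * ‖u s‖ - C)]
  have h3 : ∫ s in (0 : ℝ)..r, (2 * M ^ 2 * ‖u' s‖ ^ 2 + 2 * C ^ 2) =
      2 * M ^ 2 * (∫ s in (0 : ℝ)..r, ‖u' s‖ ^ 2) + 2 * C ^ 2 * r := by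
    rw [intervalIntegral.integral_add (Continuous.intervalIntegrable (by fun_prop) _ _)
      (Continuous.intervalIntegrable (by fun_prop) _ _), intervalIntegral.integral_const_mul,
      intervalIntegral.integral_const, smul_eq_mul]
    ring
  have h4 : C ^ 2 * r ≤ C ^ 2 * t := mul_le_mul_of_nonneg_left hr.2 (sq_nonneg C)
  simp only [hu', IccExtend_eq hT u hrT]
  simp only [hu'] at h2 h3
  linarith

/-- Superposition, used for uniqueness with `c = -1` and for linearity of the response. -/
lemma IsSolution.drift_add_smul (h₁ : D.IsSolution T (fun t => B (u t) + F₁ t) u₁ u)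
    (h₂ : D.IsSolution T (fun t => B (v t) + F₂ t) u₂ v) (hT : 0 ≤ T)
    (hF₁ : ContinuousOn F₁ (Icc 0 T)) (hF₂ : ContinuousOn F₂ (Icc 0 T)) (c : ℝ) :
    D.IsSolution T (fun t => B (u t + c • v t) + (F₁ t + c • F₂ t)) (u₁ + c • u₂)
      (fun t => u t + c • v t) := by
  refine (h₁.add_smul h₂ (continuousOn_drift h₁.1 hF₁) (continuousOn_drift h₂.1 hF₂) c).congr hT
    (fun t _ => ?_) fun t _ => rfl
  simp only [map_add, map_smul, smul_add]
  abel

theorem IsSolution.drift_unique (h₁ : D.IsSolution T (fun t => B (u t) + F t) u₀ u)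
    (h₂ : D.IsSolution T (fun t => B (v t) + F t) u₀ v) (hF : ContinuousOn F (Icc 0 T)) :
    EqOn u v (Icc 0 T) := by
  intro t ht
  have h := h₁.drift_add_smul h₂ (ht.1.trans ht.2) hF hF (-1)
  have h0 := h.drift_norm_sq_le (hF.add (hF.const_smul (-1))) le_rfl (C := 0)
    (fun s _ => by simp) ht
  have h1 : ‖u t + (-1 : ℝ) • v t‖ ^ 2 ≤ 0 := by simpa using h0
  have h2 : u t + (-1 : ℝ) • v t = 0 := by
    rw [← norm_eq_zero]
    exact pow_eq_zero_iff (two_ne_zero) |>.1 (le_antisymm h1 (sq_nonneg _))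
  rw [neg_one_smul, ← sub_eq_add_neg] at h2
  exact sub_eq_zero.1 h2

theorem exists_isSolution_drift [Countable ι] [CompleteSpace H] [CompleteSpace V] (hT : 0 ≤ T)
    (hF : ContinuousOn F (Icc 0 T)) (B : H →L[ℝ] V) (u₀ : H) :
    ∃ u, D.IsSolution T (fun t => B (u t) + F t) u₀ u := by
  have : Nonempty (Icc (0 : ℝ) T) := ⟨⟨0, le_rfl, hT⟩⟩
  have cF := continuous_IccExtend hT hF
  have hex : ∀ a : C(Icc (0 : ℝ) T, H), ∃ u,
      D.IsSolution T (fun t => B (IccExtend hT a t) + IccExtend hT (fun x : Icc 0 T => F x) t)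
        u₀ u := fun a =>
    exists_isSolution hT ((B.continuous.comp a.continuous.Icc_extend').add cF) u₀
  choose S hS using hex
  -- Picard map: solve with the drift frozen at `a`. A fixed point solves the full problem.
  set Φ : C(Icc (0 : ℝ) T, H) → C(Icc (0 : ℝ) T, H) := fun a =>
    ⟨fun t => S a t, continuousOn_iff_continuous_domRestrict.1 (hS a).1⟩ with hΦ
  have hΦapp : ∀ a, ∀ t ∈ Icc 0 T, IccExtend hT (Φ a) t = S a t := fun a t ht => by
    rw [IccExtend_of_mem hT _ ht]; rfl
  -- The difference of two images has zero initial value and forcing `B (a - a')`, so the energy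
  -- estimate applies.
  have step : ∀ a a' : C(Icc (0 : ℝ) T, H), ∀ t ∈ Icc 0 T,
      ‖IccExtend hT (Φ a) t - IccExtend hT (Φ a') t‖ ^ 2 ≤
        2 * ‖B‖ ^ 2 * ∫ s in (0 : ℝ)..t, ‖IccExtend hT a s - IccExtend hT a' s‖ ^ 2 := by
    intro a a' t ht
    have ca : Continuous (IccExtend hT a) := a.continuous.Icc_extend'
    have ca' : Continuous (IccExtend hT a') := a'.continuous.Icc_extend'
    have hc : ∀ b : C(Icc (0 : ℝ) T, H), Continuous fun t =>
        B (IccExtend hT b t) + IccExtend hT (fun x : Icc 0 T => F x) t := fun b =>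
      (B.continuous.comp b.continuous.Icc_extend').add cF
    have h := ((hS a).add_smul (hS a') (hc a).continuousOn (hc a').continuousOn (-1)).norm_sq_le
      ((hc a).add ((hc a').const_smul (-1 : ℝ))).continuousOn ht
    simp only [neg_one_smul, ← sub_eq_add_neg, sub_self, norm_zero] at h
    rw [hΦapp a t ht, hΦapp a' t ht]
    refine h.trans ?_
    rw [zero_pow two_ne_zero, zero_add, mul_assoc,
      ← intervalIntegral.integral_const_mul (‖B‖ ^ 2)]
    refine mul_le_mul_of_nonneg_left ?_ (zero_le_two (α := ℝ))
    refine intervalIntegral.integral_mono_on ht.1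
      ((((hc a).sub (hc a')).norm.pow 2).intervalIntegrable _ _)
      (Continuous.intervalIntegrable (by fun_prop) _ _) fun s _ => ?_
    rw [add_sub_add_right_eq_sub, ← map_sub, ← mul_pow]
    exact pow_le_pow_left₀ (norm_nonneg _) (B.le_opNorm _) 2
  have iter : ∀ (n : ℕ) (a a' : C(Icc (0 : ℝ) T, H)), ∀ t ∈ Icc 0 T,
      ‖IccExtend hT (Φ^[n] a) t - IccExtend hT (Φ^[n] a') t‖ ^ 2 ≤
        (2 * ‖B‖ ^ 2 * t) ^ n / n.factorial * dist a a' ^ 2 := by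
    intro n
    induction n with
    | zero =>
      intro a a' t ht
      simp only [Function.iterate_zero, id_eq, pow_zero, Nat.factorial_zero, Nat.cast_one,
        div_one, one_mul]
      refine pow_le_pow_left₀ (norm_nonneg _) ?_ 2
      rw [← dist_eq_norm]
      exact ContinuousMap.dist_apply_le_dist _
    | succ n ih =>
      intro a a' t ht
      rw [Function.iterate_succ_apply', Function.iterate_succ_apply']
      refine (step _ _ t ht).trans ?_
      have c1 : Continuous (IccExtend hT (Φ^[n] a)) := (Φ^[n] a).continuous.Icc_extend'
      have c2 : Continuous (IccExtend hT (Φ^[n] a')) := (Φ^[n] a').continuous.Icc_extend'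
      have h1 : ∫ s in (0 : ℝ)..t,
          ‖IccExtend hT (Φ^[n] a) s - IccExtend hT (Φ^[n] a') s‖ ^ 2 ≤
          ∫ s in (0 : ℝ)..t, (2 * ‖B‖ ^ 2) ^ n / n.factorial * dist a a' ^ 2 * s ^ n := by
        refine intervalIntegral.integral_mono_on ht.1
          (Continuous.intervalIntegrable (by fun_prop) _ _)
          (Continuous.intervalIntegrable (by fun_prop) _ _) fun s hs => ?_
        refine (ih a a' s ⟨hs.1, hs.2.trans ht.2⟩).trans_eq ?_
        rw [mul_pow _ s]; ring
      rw [intervalIntegral.integral_const_mul, integral_pow] at h1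
      refine (mul_le_mul_of_nonneg_left h1 (by positivity)).trans_eq ?_
      rw [Nat.factorial_succ]
      push_cast
      have h2 : (n : ℝ) + 1 ≠ 0 := by positivity
      have h3 : (n.factorial : ℝ) ≠ 0 := by positivity
      field_simp
      ring
  -- The factorial makes some iterate a contraction for any `T`; `1 / 4` is the square of the ratio
  -- `1 / 2`, as `iter` bounds squared norms.
  obtain ⟨n, hn⟩ : ∃ n : ℕ, (2 * ‖B‖ ^ 2 * T) ^ n / n.factorial < 1 / 4 :=
    ((FloorSemiring.tendsto_pow_div_factorial_atTop (2 * ‖B‖ ^ 2 * T)).eventually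
      (gt_mem_nhds (by norm_num : (0 : ℝ) < 1 / 4))).exists
  have hcontr : ContractingWith (1 / 2) Φ^[n] := by
    refine ⟨by rw [← NNReal.coe_lt_coe]; norm_num, LipschitzWith.of_dist_le_mul fun a a' => ?_⟩
    rw [ContinuousMap.dist_le (by positivity)]
    intro x
    have h1 := iter n a a' x x.2
    have h2 : (2 * ‖B‖ ^ 2 * (x : ℝ)) ^ n / n.factorial ≤ 1 / 4 := by
      refine le_trans ?_ hn.le
      have := x.2.1
      have := x.2.2
      gcongr
    rw [IccExtend_of_mem hT _ x.2, IccExtend_of_mem hT _ x.2, ← dist_eq_norm] at h1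
    refine le_of_sq_le_sq ?_ (by positivity)
    refine h1.trans ((mul_le_mul_of_nonneg_right h2 (sq_nonneg _)).trans_eq ?_)
    rw [mul_pow]
    norm_num
  obtain ⟨a, ha⟩ : ∃ a, Φ a = a := ⟨_, hcontr.isFixedPt_fixedPoint_iterate⟩
  refine ⟨S a, (hS a).congr hT (fun t ht => ?_) fun t _ => rfl⟩
  simp only [← hΦapp a t ht, ha, IccExtend_eq hT F ht]

end SpectralGradient

end

/-! ### The weak gradient on the torus. -/

noncomputable section

namespace FokkerPlanck

open Filter Topology UnitAddTorus

variable {d : ℕ}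

/-- The projection `ℝ^d → 𝕋^d`. -/
def torusMk (y : Fin d → ℝ) : Torus d := fun i => (y i : UnitAddCircle)

lemma isOpenQuotientMap_torusMk : IsOpenQuotientMap (torusMk (d := d)) :=
  IsOpenQuotientMap.piMap fun _ => QuotientAddGroup.isOpenQuotientMap_mk

lemma torusMk_add_single (y : Fin d → ℝ) (i : Fin d) (s : ℝ) :
    torusMk (y + Pi.single i s) = torusMk y + Pi.single i (s : UnitAddCircle) := by
  ext j
  rcases eq_or_ne j i with rfl | h
  · simp [torusMk]
  · simp [torusMk, h]

lemma IsSmooth.continuous {φ : Torus d → ℝ} (h : IsSmooth φ) : Continuous φ :=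
  isOpenQuotientMap_torusMk.continuous_comp_iff.1 (ContDiff.continuous h)

lemma IsSmooth.hasDerivAt {φ : Torus d → ℝ} (h : IsSmooth φ) (i : Fin d) (y : Fin d → ℝ) :
    HasDerivAt (fun s : ℝ => φ (torusMk y + Pi.single i (s : UnitAddCircle)))
      (fderiv ℝ (fun y => φ (torusMk y)) y (Pi.single i 1)) 0 := by
  simp only [← torusMk_add_single]
  have h1 : HasFDerivAt (fun y => φ (torusMk y)) (fderiv ℝ (fun y => φ (torusMk y)) y)
      (y + Pi.single i (0 : ℝ)) := by
    rw [Pi.single_zero, add_zero]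
    exact (ContDiff.differentiable h (by simp) y).hasFDerivAt
  have h2 : HasDerivAt (fun s : ℝ => y + Pi.single i s) (Pi.single i (1 : ℝ)) 0 :=
    (hasDerivAt_single i (0 : ℝ)).const_add y
  exact h1.comp_hasDerivAt (0 : ℝ) h2

lemma IsSmooth.continuous_partialDeriv {φ : Torus d → ℝ} (h : IsSmooth φ) (i : Fin d) :
    Continuous (partialDeriv i φ) := by
  refine isOpenQuotientMap_torusMk.continuous_comp_iff.1 ?_
  have : partialDeriv i φ ∘ torusMk =
      fun y => fderiv ℝ (fun y => φ (torusMk y)) y (Pi.single i 1) :=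
    funext fun y => (h.hasDerivAt i y).deriv
  rw [this]
  exact (ContDiff.continuous_fderiv h (by simp)).clm_apply continuous_const

lemma IsSmooth.hasDerivAt_translate {φ : Torus d → ℝ} (h : IsSmooth φ) (i : Fin d) (x : Torus d)
    (s : ℝ) : HasDerivAt (fun s : ℝ => φ (x + Pi.single i (s : UnitAddCircle)))
      (partialDeriv i φ (x + Pi.single i (s : UnitAddCircle))) s := by
  obtain ⟨y, hy⟩ := isOpenQuotientMap_torusMk.surjective (x + Pi.single i (s : UnitAddCircle))
  have h1 := h.hasDerivAt i y
  have h2 := h1.differentiableAt.hasDerivAt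
  rw [hy] at h2
  have h3 : HasDerivAt (fun r : ℝ => φ (x + Pi.single i (s : UnitAddCircle) +
      Pi.single i (r : UnitAddCircle))) (partialDeriv i φ (x + Pi.single i (s : UnitAddCircle)))
      (s - s) := by rw [sub_self]; exact h2
  have h4 := h3.comp_sub_const s s
  refine h4.congr_of_eventuallyEq (Eventually.of_forall fun r => ?_)
  simp only [add_assoc, ← Pi.single_add]
  congr 3
  rw [← AddCircle.coe_add, add_sub_cancel]

lemma inner_toLp (u : L2 d) (φ : C(Torus d, ℝ)) :
    inner ℝ u (φ.toLp 2 (torusMeasure d) ℝ) = ∫ x, u x * φ x ∂(torusMeasure d) := by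
  rw [L2.inner_def]
  refine integral_congr_ae ?_
  filter_upwards [ContinuousMap.coeFn_toLp (𝕜 := ℝ) (p := 2) (torusMeasure d) φ] with x hx
  rw [hx, RCLike.inner_apply, conj_trivial, mul_comm]

lemma inner_toLp_vec (G : L2Vec d) (ψ : C(Torus d, EuclideanSpace ℝ (Fin d))) :
    inner ℝ G (ψ.toLp 2 (torusMeasure d) ℝ) =
      ∫ x, ∑ j, G x j * ψ x j ∂(torusMeasure d) := by
  rw [L2.inner_def]
  refine integral_congr_ae ?_
  filter_upwards [ContinuousMap.coeFn_toLp (𝕜 := ℝ) (p := 2) (torusMeasure d) ψ] with x hx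
  rw [hx, PiLp.inner_apply]
  simp only [RCLike.inner_apply, conj_trivial, mul_comm]

/-- Both sides of the weak gradient identity are inner products with fixed `L²` elements; linearity
and closedness of the graph follow at once. -/
lemma exists_test_inner {φ : Torus d → ℝ} (h : IsSmooth φ) (i : Fin d) :
    ∃ (a : L2 d) (c : L2Vec d), ∀ (u : L2 d) (G : L2Vec d),
      (∫ x, u x * partialDeriv i φ x ∂(torusMeasure d) = inner ℝ u a) ∧
      (∫ x, G x i * φ x ∂(torusMeasure d) = inner ℝ G c) := by
  refine ⟨ContinuousMap.toLp 2 (torusMeasure d) ℝ ⟨_, h.continuous_partialDeriv i⟩,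
    ContinuousMap.toLp 2 (torusMeasure d) ℝ
      ⟨fun x => φ x • EuclideanSpace.single i (1 : ℝ), h.continuous.smul continuous_const⟩,
    fun u G => ⟨(inner_toLp u ⟨_, h.continuous_partialDeriv i⟩).symm, ?_⟩⟩
  rw [inner_toLp_vec]
  refine integral_congr_ae (Eventually.of_forall fun x => ?_)
  simp

/-- The graph of the weak gradient. -/
def weakGradientGraph (d : ℕ) : Submodule ℝ (L2 d × L2Vec d) where
  carrier := {p | HasWeakGradient p.1 p.2}
  add_mem' {p q} hp hq φ hφ i := by
    obtain ⟨a, c, h⟩ := exists_test_inner hφ i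
    have h1 := hp φ hφ i
    have h2 := hq φ hφ i
    simp only [(h _ 0).1, (h 0 _).2] at h1 h2 ⊢
    simp only [Prod.fst_add, Prod.snd_add, inner_add_left, h1, h2, neg_add]
  zero_mem' φ hφ i := by
    obtain ⟨a, c, h⟩ := exists_test_inner hφ i
    simp only [(h _ 0).1, (h 0 _).2]
    simp
  smul_mem' r p hp φ hφ i := by
    obtain ⟨a, c, h⟩ := exists_test_inner hφ i
    have h1 := hp φ hφ i
    simp only [(h _ 0).1, (h 0 _).2] at h1 ⊢
    simp only [Prod.smul_fst, Prod.smul_snd, inner_smul_left, h1, mul_neg]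

lemma isClosed_weakGradientGraph : IsClosed (weakGradientGraph d : Set (L2 d × L2Vec d)) := by
  have : (weakGradientGraph d : Set (L2 d × L2Vec d)) =
      ⋂ (φ : Torus d → ℝ) (_ : IsSmooth φ) (i : Fin d), {p |
        ∫ x, p.1 x * partialDeriv i φ x ∂(torusMeasure d) =
          -∫ x, p.2 x i * φ x ∂(torusMeasure d)} := by
    ext p
    simp only [mem_iInter]
    rfl
  rw [this]
  refine isClosed_iInter fun φ => isClosed_iInter fun hφ => isClosed_iInter fun i => ?_
  obtain ⟨a, c, h⟩ := exists_test_inner hφ i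
  simp only [(h _ 0).1, (h 0 _).2]
  exact isClosed_eq (continuous_fst.inner continuous_const)
    (continuous_snd.inner continuous_const).neg

/-! ### The Hartley basis -/

/-- The function `cos (2 π k · x) + sin (2 π k · x)`. -/
def hartley (k : Fin d → ℤ) : C(Torus d, ℝ) :=
  ⟨fun x => (mFourier k x).re + (mFourier k x).im, by fun_prop⟩

lemma mFourier_torusMk (k : Fin d → ℤ) (y : Fin d → ℝ) :
    mFourier k (torusMk y) = Complex.exp ((2 * Real.pi * ∑ i, k i * y i : ℝ) * Complex.I) := by
  simp only [mFourier, ContinuousMap.coe_mk, torusMk, fourier_coe_apply]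
  rw [← Complex.exp_sum]
  congr 1
  push_cast
  rw [Finset.mul_sum, Finset.sum_mul]
  refine Finset.sum_congr rfl fun i _ => ?_
  ring

lemma hartley_torusMk (k : Fin d → ℤ) (y : Fin d → ℝ) :
    hartley k (torusMk y) = Real.cos (2 * Real.pi * ∑ i, k i * y i) +
      Real.sin (2 * Real.pi * ∑ i, k i * y i) := by
  simp only [hartley, ContinuousMap.coe_mk, mFourier_torusMk]
  rw [Complex.exp_ofReal_mul_I_re, Complex.exp_ofReal_mul_I_im]

lemma hartley_neg_torusMk (k : Fin d → ℤ) (y : Fin d → ℝ) :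
    hartley (-k) (torusMk y) = Real.cos (2 * Real.pi * ∑ i, k i * y i) -
      Real.sin (2 * Real.pi * ∑ i, k i * y i) := by
  rw [hartley_torusMk]
  simp [Finset.sum_neg_distrib, sub_eq_add_neg]

/-- Translation rotates the pair `hartley k`, `hartley (-k)`. This gives both the partial
derivatives and the integration by parts. -/
lemma hartley_add_single (k : Fin d → ℤ) (x : Torus d) (j : Fin d) (s : ℝ) :
    hartley k (x + Pi.single j (s : UnitAddCircle)) =
      Real.cos (2 * Real.pi * k j * s) * hartley k x +
        Real.sin (2 * Real.pi * k j * s) * hartley (-k) x := by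
  obtain ⟨y, rfl⟩ := isOpenQuotientMap_torusMk.surjective x
  rw [← torusMk_add_single, hartley_torusMk, hartley_torusMk, hartley_neg_torusMk]
  have : 2 * Real.pi * ∑ i, (k i : ℝ) * ((y + Pi.single j s : Fin d → ℝ) i) =
      2 * Real.pi * ∑ i, k i * y i + 2 * Real.pi * k j * s := by
    simp only [Pi.add_apply, mul_add, Finset.sum_add_distrib, Pi.single_apply, mul_ite, mul_zero,
      Finset.sum_ite_eq', Finset.mem_univ, if_true]
    ring
  rw [this, Real.cos_add, Real.sin_add]
  ring

lemma isSmooth_hartley (k : Fin d → ℤ) : IsSmooth (hartley k) := by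
  have : (fun y : Fin d → ℝ => hartley k fun i => (y i : UnitAddCircle)) = fun y =>
      Real.cos (2 * Real.pi * ∑ i, (k i : ℝ) * y i) +
        Real.sin (2 * Real.pi * ∑ i, (k i : ℝ) * y i) :=
    funext fun y => hartley_torusMk k y
  unfold IsSmooth
  rw [this]
  have h : ContDiff ℝ ∞ fun y : Fin d → ℝ => 2 * Real.pi * ∑ i, (k i : ℝ) * y i :=
    contDiff_const.mul (ContDiff.sum fun i _ => contDiff_const.mul (contDiff_apply ℝ ℝ i))
  exact h.cos.add h.sin

lemma partialDeriv_hartley (k : Fin d → ℤ) (j : Fin d) (x : Torus d) :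
    partialDeriv j (hartley k) x = 2 * Real.pi * k j * hartley (-k) x := by
  unfold partialDeriv
  simp only [hartley_add_single]
  have h := (hasDerivAt_id (0 : ℝ)).const_mul (2 * Real.pi * k j)
  have := ((h.cos.mul_const (hartley k x)).add (h.sin.mul_const (hartley (-k) x))).deriv
  simpa using! this

lemma integrable_of_continuous {f : Torus d → ℝ} (hf : Continuous f) :
    Integrable f (torusMeasure d) :=
  hf.integrable_of_hasCompactSupport (HasCompactSupport.of_compactSpace _)

lemma hasDerivAt_integral_translate {h φ : Torus d → ℝ} (hh : Continuous h) (hφ : IsSmooth φ)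
    (j : Fin d) :
    HasDerivAt (fun s : ℝ => ∫ x, h x * φ (x + Pi.single j (s : UnitAddCircle)) ∂(torusMeasure d))
      (∫ x, h x * partialDeriv j φ x ∂(torusMeasure d)) 0 := by
  have hφc := hφ.continuous
  have hdc := hφ.continuous_partialDeriv j
  obtain ⟨C₁, hC₁⟩ := isCompact_univ.exists_bound_of_continuousOn hh.continuousOn
  obtain ⟨C₂, hC₂⟩ := isCompact_univ.exists_bound_of_continuousOn hdc.continuousOn
  set F : ℝ → Torus d → ℝ := fun s x => h x * φ (x + Pi.single j (s : UnitAddCircle))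
  set F' : ℝ → Torus d → ℝ := fun s x =>
    h x * partialDeriv j φ (x + Pi.single j (s : UnitAddCircle)) with hF'
  have hFc : ∀ s, Continuous (F s) := fun s =>
    hh.mul (hφc.comp (continuous_id.add continuous_const))
  have hFc' : ∀ s, Continuous (F' s) := fun s =>
    hh.mul (hdc.comp (continuous_id.add continuous_const))
  have hb : ∀ᵐ x ∂(torusMeasure d), ∀ s ∈ (univ : Set ℝ), ‖F' s x‖ ≤ C₁ * C₂ := by
    refine Eventually.of_forall fun x s _ => ?_
    rw [hF', norm_mul]
    exact mul_le_mul (hC₁ x trivial) (hC₂ _ trivial) (norm_nonneg _)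
      ((norm_nonneg _).trans (hC₁ x trivial))
  have hd : ∀ᵐ x ∂(torusMeasure d), ∀ s ∈ (univ : Set ℝ),
      HasDerivAt (fun s => F s x) (F' s x) s :=
    Eventually.of_forall fun x s _ => (hφ.hasDerivAt_translate j x s).const_mul _
  have hF0 : F' 0 = fun x => h x * partialDeriv j φ x := by
    funext x
    simp only [hF', AddCircle.coe_zero, Pi.single_zero, add_zero]
  have := (hasDerivAt_integral_of_dominated_loc_of_deriv_le (F := F) (F' := F') (x₀ := 0)
      (bound := fun _ => C₁ * C₂) univ_mem
      (Eventually.of_forall fun s => (hFc s).aestronglyMeasurable)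
      (integrable_of_continuous (hFc 0)) (hFc' 0).aestronglyMeasurable hb
      (integrable_const _) hd).2
  rwa [hF0] at this

/-- Integration by parts from invariance of the measure: differentiate `∫ h(x) φ(x + s e_j) dx` at
`s = 0`, once under the integral and once after shifting the translation onto `h`. -/
lemma integral_hartley_mul_partialDeriv (k : Fin d → ℤ) {φ : Torus d → ℝ} (hφ : IsSmooth φ)
    (j : Fin d) :
    ∫ x, hartley k x * partialDeriv j φ x ∂(torusMeasure d) =
      -∫ x, (2 * Real.pi * k j * hartley (-k) x) * φ x ∂(torusMeasure d) := by
  have hφc := hφ.continuous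
  have hleft := hasDerivAt_integral_translate (hartley k).continuous hφ j
  set A := ∫ x, hartley k x * φ x ∂(torusMeasure d)
  set B := ∫ x, hartley (-k) x * φ x ∂(torusMeasure d)
  have heq : ∀ s : ℝ, ∫ x, hartley k x * φ (x + Pi.single j (s : UnitAddCircle))
      ∂(torusMeasure d) = Real.cos (2 * Real.pi * k j * s) * A -
        Real.sin (2 * Real.pi * k j * s) * B := by
    intro s
    rw [← integral_add_right_eq_self _ (Pi.single j ((-s : ℝ) : UnitAddCircle))]
    have : ∀ x : Torus d, hartley k (x + Pi.single j ((-s : ℝ) : UnitAddCircle)) *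
        φ (x + Pi.single j ((-s : ℝ) : UnitAddCircle) + Pi.single j (s : UnitAddCircle)) =
        Real.cos (2 * Real.pi * k j * s) * (hartley k x * φ x) -
          Real.sin (2 * Real.pi * k j * s) * (hartley (-k) x * φ x) := by
      intro x
      rw [add_assoc, ← Pi.single_add, ← AddCircle.coe_add, neg_add_cancel, hartley_add_single]
      simp only [AddCircle.coe_zero, Pi.single_zero, add_zero, mul_neg, Real.cos_neg,
        Real.sin_neg]
      ring
    simp only [this]
    rw [integral_sub ((integrable_of_continuous (by fun_prop)).const_mul _)
      ((integrable_of_continuous (by fun_prop)).const_mul _),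
      integral_const_mul, integral_const_mul]
  simp only [heq] at hleft
  have h := (hasDerivAt_id (0 : ℝ)).const_mul (2 * Real.pi * k j)
  have hright := (h.cos.mul_const A).sub (h.sin.mul_const B)
  have := hleft.unique hright
  rw [this]
  simp only [mul_assoc, integral_const_mul]
  simp [B]

end FokkerPlanck

end

/-! ### Completeness of the Hartley system and diagonalisation of the gradient. -/

noncomputable section

namespace FokkerPlanck

open Filter Topology UnitAddTorus

variable {d : ℕ}

lemma integral_mFourier (n : Fin d → ℤ) :
    ∫ x, mFourier n x ∂(torusMeasure d) = if n = 0 then 1 else 0 := by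
  have h := orthonormal_iff_ite.1 (orthonormal_mFourier (d := Fin d)) 0 n
  rw [ContinuousMap.inner_toLp] at h
  simp only [mFourier_zero, ContinuousMap.one_apply, map_one, mul_one,
    eq_comm (a := (0 : Fin d → ℤ))] at h
  exact h

/-- Reduces orthonormality to integrals of single characters. -/
lemma hartley_mul_hartley (k l : Fin d → ℤ) (x : Torus d) :
    hartley k x * hartley l x = (mFourier (k + -l) x).re + (mFourier (k + l) x).im := by
  simp only [hartley, ContinuousMap.coe_mk, mFourier_add, mFourier_neg, Complex.mul_re,
    Complex.mul_im, Complex.conj_re, Complex.conj_im]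
  ring

lemma integral_hartley_mul_hartley (k l : Fin d → ℤ) :
    ∫ x, hartley k x * hartley l x ∂(torusMeasure d) = if k = l then 1 else 0 := by
  have hi : ∀ n : Fin d → ℤ, Integrable (mFourier n) (torusMeasure d) := fun n =>
    (mFourier n).continuous.integrable_of_hasCompactSupport (.of_compactSpace _)
  simp only [hartley_mul_hartley]
  have h1 := integral_re (hi (k + -l))
  have h2 := integral_im (hi (k + l))
  simp only [RCLike.re_eq_complex_re, RCLike.im_eq_complex_im] at h1 h2
  have hre : Integrable (fun x => (mFourier (k + -l) x).re) (torusMeasure d) := (hi _).re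
  have him : Integrable (fun x => (mFourier (k + l) x).im) (torusMeasure d) := (hi _).im
  rw [integral_add hre him, h1, h2, integral_mFourier, integral_mFourier, ← sub_eq_add_neg]
  simp only [sub_eq_zero]
  split_ifs <;> simp

/-- The Hartley functions as elements of `L²`. -/
def hartleyL2 (k : Fin d → ℤ) : L2 d := (hartley k).toLp 2 (torusMeasure d) ℝ

lemma coeFn_hartleyL2 (k : Fin d → ℤ) : hartleyL2 k =ᵐ[torusMeasure d] hartley k :=
  ContinuousMap.coeFn_toLp (𝕜 := ℝ) (torusMeasure d) (hartley k)

lemma orthonormal_hartleyL2 : Orthonormal ℝ (hartleyL2 (d := d)) := by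
  rw [orthonormal_iff_ite]
  intro k l
  rw [← integral_hartley_mul_hartley, hartleyL2, hartleyL2, inner_toLp]
  refine integral_congr_ae ?_
  filter_upwards [coeFn_hartleyL2 k] with x hx
  rw [← hx]; rfl

lemma mFourier_neg_eq (n : Fin d → ℤ) (x : Torus d) :
    mFourier (-n) x = (1 - Complex.I) / 2 * (hartley n x : ℝ) +
      (1 + Complex.I) / 2 * (hartley (-n) x : ℝ) := by
  simp only [hartley, ContinuousMap.coe_mk, mFourier_neg]
  apply Complex.ext <;> simp <;> ring

/-- Complex Fourier coefficients of `f` are combinations of its integrals against `hartley n` and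
`hartley (-n)`, so completeness is inherited from Fourier series. -/
lemma eq_zero_of_integral_hartley {f : L2 d}
    (hf : ∀ k, ∫ x, f x * hartley k x ∂(torusMeasure d) = 0) : f = 0 := by
  have hm : MemLp (fun x => (f x : ℂ)) 2 (torusMeasure d) := (Lp.memLp f).ofReal
  have hint : ∀ k, Integrable (fun x => f x * hartley k x) (torusMeasure d) := fun k =>
    (Lp.memLp f).integrable_mul (q := 2) (MemLp.of_bound (hartley k).continuous.aestronglyMeasurable
      ‖hartley k‖ (Eventually.of_forall fun x => (hartley k).norm_coe_le_norm x))
  set F : Lp ℂ 2 (torusMeasure d) := hm.toLp with hF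
  have hFae : F =ᵐ[torusMeasure d] fun x => (f x : ℂ) := hm.coeFn_toLp
  have hcoef : ∀ n, mFourierCoeff F n = 0 := by
    intro n
    have : mFourierCoeff F n = ∫ x, ((1 - Complex.I) / 2 * ((f x * hartley n x : ℝ) : ℂ) +
        (1 + Complex.I) / 2 * ((f x * hartley (-n) x : ℝ) : ℂ)) ∂(torusMeasure d) := by
      refine integral_congr_ae ?_
      filter_upwards [hFae] with x hx
      rw [hx, mFourier_neg_eq, smul_eq_mul]
      push_cast
      ring
    rw [this, integral_add ((hint n).ofReal.const_mul _) ((hint (-n)).ofReal.const_mul _),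
      integral_const_mul, integral_const_mul, integral_complex_ofReal, integral_complex_ofReal,
      hf, hf]
    simp
  have hzero : F = 0 := by
    have h := hasSum_mFourier_series_L2 F
    simp only [hcoef, zero_smul] at h
    exact h.unique hasSum_zero
  rw [Lp.eq_zero_iff_ae_eq_zero]
  rw [hzero] at hFae
  filter_upwards [hFae, Lp.coeFn_zero ℂ 2 (torusMeasure d)] with x h1 h2
  rw [h2] at h1
  exact Complex.ofReal_eq_zero.1 h1.symm

/-- The Hartley basis of `L²(𝕋^d)`. -/
def hartleyBasis (d : ℕ) : HilbertBasis (Fin d → ℤ) ℝ (L2 d) :=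
  HilbertBasis.mkOfOrthogonalEqBot orthonormal_hartleyL2 <| by
    rw [Submodule.eq_bot_iff]
    intro f hf
    refine eq_zero_of_integral_hartley fun k => ?_
    rw [← inner_toLp]
    exact Submodule.inner_left_of_mem_orthogonal (Submodule.subset_span (mem_range_self k)) hf

lemma hartleyBasis_apply (k : Fin d → ℤ) : hartleyBasis d k = hartleyL2 k :=
  congrFun (HilbertBasis.coe_mkOfOrthogonalEqBot _ _) k

/-- The gradient of a Hartley function. -/
def hartleyGrad (k : Fin d → ℤ) : C(Torus d, EuclideanSpace ℝ (Fin d)) :=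
  ⟨fun x => hartley (-k) x • WithLp.toLp 2 fun j => 2 * Real.pi * k j, by fun_prop⟩

lemma hartleyGrad_apply (k : Fin d → ℤ) (x : Torus d) (j : Fin d) :
    hartleyGrad k x j = 2 * Real.pi * k j * hartley (-k) x := by
  simp [hartleyGrad, mul_comm]

lemma hasWeakGradient_hartley (k : Fin d → ℤ) :
    HasWeakGradient (hartleyL2 k) ((hartleyGrad k).toLp 2 (torusMeasure d) ℝ) := by
  intro φ hφ j
  have h := integral_hartley_mul_partialDeriv k hφ j
  simp only [← hartleyGrad_apply] at h
  refine Eq.trans (integral_congr_ae ?_) (h.trans (congrArg _ (integral_congr_ae ?_)))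
  · filter_upwards [coeFn_hartleyL2 k] with x hx
    rw [hx]
  · filter_upwards [ContinuousMap.coeFn_toLp (𝕜 := ℝ) (p := 2) (torusMeasure d) (hartleyGrad k)]
      with x hx
    rw [hx]

/-- The weak gradient identity is tested with `hartley (-k)`, whose partial derivatives are
multiples of `hartley k`. -/
lemma HasWeakGradient.inner_hartleyGrad {v : L2 d} {w : L2Vec d} (h : HasWeakGradient v w)
    (k : Fin d → ℤ) : inner ℝ w ((hartleyGrad k).toLp 2 (torusMeasure d) ℝ) =
      (∑ j, (2 * Real.pi * k j) ^ 2) * inner ℝ v (hartleyL2 k) := by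
  have hj : ∀ j, ∫ x, w x j * hartley (-k) x ∂(torusMeasure d) =
      2 * Real.pi * k j * inner ℝ v (hartleyL2 k) := by
    intro j
    have h1 := h _ (isSmooth_hartley (-k)) j
    rw [hartleyL2, inner_toLp, ← integral_const_mul, ← neg_eq_iff_eq_neg.2 h1, ← integral_neg]
    refine integral_congr_ae (Eventually.of_forall fun x => ?_)
    simp only [partialDeriv_hartley, neg_neg, Pi.neg_apply, Int.cast_neg]
    ring
  have hint : ∀ j, Integrable (fun x => w x j * hartley (-k) x) (torusMeasure d) := by
    intro j
    have hw : MemLp (fun x => w x j) 2 (torusMeasure d) :=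
      (EuclideanSpace.proj (𝕜 := ℝ) j).comp_memLp' (Lp.memLp w)
    exact hw.integrable_mul (q := 2) (MemLp.of_bound
      (hartley (-k)).continuous.aestronglyMeasurable ‖hartley (-k)‖
      (Eventually.of_forall fun x => (hartley (-k)).norm_coe_le_norm x))
  rw [inner_toLp_vec, Finset.sum_mul]
  have : ∀ x, ∑ j, w x j * hartleyGrad k x j =
      ∑ j, 2 * Real.pi * k j * (w x j * hartley (-k) x) := fun x =>
    Finset.sum_congr rfl fun j _ => by rw [hartleyGrad_apply]; ring
  simp only [this]
  rw [integral_finsetSum _ fun j _ => (hint j).const_mul _]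
  refine Finset.sum_congr rfl fun j _ => ?_
  rw [integral_const_mul, hj]
  ring

/-- Each component of `w` integrates to zero against every Hartley function. -/
lemma HasWeakGradient.eq_zero {w : L2Vec d} (h : HasWeakGradient 0 w) : w = 0 := by
  have hw : ∀ j, MemLp (fun x => w x j) 2 (torusMeasure d) := fun j =>
    (EuclideanSpace.proj (𝕜 := ℝ) j).comp_memLp' (Lp.memLp w)
  have hj : ∀ j, (hw j).toLp = 0 := by
    intro j
    refine eq_zero_of_integral_hartley fun k => ?_
    have h1 := h _ (isSmooth_hartley k) j
    rw [← neg_eq_iff_eq_neg] at h1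
    refine Eq.trans (integral_congr_ae ?_) (h1.symm.trans ?_)
    · filter_upwards [(hw j).coeFn_toLp] with x hx
      rw [hx]
    · rw [neg_eq_zero, ← integral_zero (Torus d) ℝ (μ := torusMeasure d)]
      refine integral_congr_ae ?_
      filter_upwards [Lp.coeFn_zero ℝ 2 (torusMeasure d)] with x hx
      rw [hx]
      simp
  rw [Lp.eq_zero_iff_ae_eq_zero]
  have hae : ∀ᵐ x ∂(torusMeasure d), ∀ j, w x j = 0 := by
    rw [ae_all_iff]
    intro j
    have h1 := (hw j).coeFn_toLp
    rw [hj j] at h1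
    filter_upwards [h1, Lp.coeFn_zero ℝ 2 (torusMeasure d)] with x h2 h3
    rw [← h2, h3, Pi.zero_apply]
  filter_upwards [hae] with x hx
  ext j
  simpa using hx j

/-- The weak gradient on the torus. -/
def torusGradient (d : ℕ) : SpectralGradient (Fin d → ℤ) (L2 d) (L2Vec d) where
  graph := weakGradientGraph d
  isClosed_graph := isClosed_weakGradientGraph
  basis := hartleyBasis d
  grad k := (hartleyGrad k).toLp 2 (torusMeasure d) ℝ
  eig k := ∑ j, (2 * Real.pi * k j) ^ 2
  basis_mem k := by
    rw [hartleyBasis_apply]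
    exact hasWeakGradient_hartley k
  inner_grad v w h k := by
    rw [hartleyBasis_apply]
    exact HasWeakGradient.inner_hartleyGrad h k
  eq_zero _ h := HasWeakGradient.eq_zero h

/-- `u ↦ u b` as a bounded operator `L²(𝕋^d) → L²(𝕋^d; ℝ^d)`. -/
def fluxL (b : LinftyVec d) : L2 d →L[ℝ] L2Vec d :=
  LinearMap.mkContinuous
    { toFun := fun u => flux u b
      map_add' := fun u v => Lp.smul_add u v b
      map_smul' := fun c u => Lp.smul_assoc c u b } ‖b‖
    fun u => (Lp.norm_smul_le u b).trans_eq (mul_comm _ _)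

lemma norm_fluxL_le (b : LinftyVec d) : ‖fluxL b‖ ≤ ‖b‖ :=
  LinearMap.mkContinuous_norm_le _ (norm_nonneg b) _

lemma norm_flux_le (u : L2 d) (b : LinftyVec d) : ‖flux u b‖ ≤ ‖u‖ * ‖b‖ :=
  Lp.norm_smul_le u b

lemma flux_add_smul (u : L2 d) (b b' : LinftyVec d) (c : ℝ) :
    flux u (b + c • b') = flux u b + c • flux u b' := by
  unfold flux
  rw [Lp.add_smul, Lp.smul_comm]

lemma isVariationalSolution_iff {T : ℝ} {b : LinftyVec d} {F : ℝ → L2Vec d} {u₀ : L2 d}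
    {u : ℝ → L2 d} : IsVariationalSolution T b F u₀ u ↔
      (torusGradient d).IsSolution T (fun t => fluxL b (u t) + F t) u₀ u := Iff.rfl

lemma exists_unique_isVariationalSolution {T : ℝ} (hT : 0 ≤ T) (b : LinftyVec d)
    {F : ℝ → L2Vec d} (hF : ContinuousOn F (Icc 0 T)) (u₀ : L2 d) :
    ∃ u, IsVariationalSolution T b F u₀ u ∧
      ∀ q, IsVariationalSolution T b F u₀ q → EqOn q u (Icc 0 T) := by
  obtain ⟨u, hu⟩ := (torusGradient d).exists_isSolution_drift hT hF (fluxL b) u₀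
  exact ⟨u, hu, fun q hq => SpectralGradient.IsSolution.drift_unique
    (isVariationalSolution_iff.1 hq) hu hF⟩

lemma IsVariationalSolution.norm_sq_le {T M C : ℝ} {b : LinftyVec d} {F : ℝ → L2Vec d} {u₀ : L2 d}
    {u : ℝ → L2 d} (h : IsVariationalSolution T b F u₀ u) (hF : ContinuousOn F (Icc 0 T))
    (hb : ‖b‖ ≤ M) (hC : ∀ t ∈ Icc 0 T, ‖F t‖ ≤ C) {t : ℝ} (ht : t ∈ Icc 0 T) :
    ‖u t‖ ^ 2 ≤ (‖u₀‖ ^ 2 + 4 * C ^ 2 * t) * Real.exp (4 * M ^ 2 * t) :=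
  SpectralGradient.IsSolution.drift_norm_sq_le (isVariationalSolution_iff.1 h) hF
    ((norm_fluxL_le b).trans hb) hC ht

/-- Mass is conserved. -/
lemma IsVariationalSolution.integral_eq {T : ℝ} {b : LinftyVec d} {F : ℝ → L2Vec d} {u₀ : L2 d}
    {u : ℝ → L2 d} (h : IsVariationalSolution T b F u₀ u) {t : ℝ} (ht : t ∈ Icc 0 T) :
    ∫ x, u t x ∂(torusMeasure d) = ∫ x, u₀ x ∂(torusMeasure d) := by
  -- `hartley 0` is the constant `1`; its gradient vanishes, so testing with it kills the integral
  -- term.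
  have hone : ∀ f : L2 d, inner ℝ f (hartleyL2 0) = ∫ x, f x ∂(torusMeasure d) := fun f => by
    rw [hartleyL2, inner_toLp]
    simp [hartley, mFourier_zero]
  have hgrad : hartleyGrad (0 : Fin d → ℤ) = 0 := by
    ext x j
    rw [hartleyGrad_apply]
    simp
  have hw := hasWeakGradient_hartley (0 : Fin d → ℤ)
  rw [hgrad, map_zero] at hw
  obtain ⟨-, -, G, -, -, he⟩ := h
  have := he _ _ hw t ht
  simpa [hone] using this

end FokkerPlanck

end

/-! ### The linear response. -/

theorem proposition3 (d : ℕ) (T : ℝ) (hT : 0 < T) (M : ℝ) :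
    ∃ K : ℝ, 0 < K ∧
      ∀ b : FokkerPlanck.LinftyVec d, ‖b‖ ≤ M → ∀ p₀ : FokkerPlanck.L2 d,
        -- the solution `p` of the unperturbed Fokker-Planck equation exists and is unique
        ∃ p : ℝ → FokkerPlanck.L2 d,
          FokkerPlanck.IsFokkerPlanckSolution T b p₀ p ∧
          (∀ q, FokkerPlanck.IsFokkerPlanckSolution T b p₀ q → Set.EqOn q p (Set.Icc 0 T)) ∧
          -- for every `η` the solution `r η` of the response equation exists and is unique
          ∃ r : FokkerPlanck.LinftyVec d → ℝ → FokkerPlanck.L2 d,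
            (∀ η, FokkerPlanck.IsResponseSolution T b p η (r η) ∧
              ∀ q, FokkerPlanck.IsResponseSolution T b p η q →
                Set.EqOn q (r η) (Set.Icc 0 T)) ∧
            ∀ τ ∈ Set.Ioc 0 T,
              IsLinearMap ℝ (fun η => r η τ) ∧
              Continuous (fun η => r η τ) ∧
              (∀ η, ‖r η τ‖ ≤ K * τ ^ (1 / 2 : ℝ) * ‖p₀‖ * ‖η‖) ∧
              ∀ η, ∫ x, r η τ x ∂(FokkerPlanck.torusMeasure d) = 0 := by
  open FokkerPlanck in
  set E := Real.exp (2 * M ^ 2 * T) with hE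
  -- One `E` comes from the bound on `p`, the other from Gronwall for `r`, and `2` is the square
  -- root of the 4 in `norm_sq_le`.
  refine ⟨2 * E * E, by positivity, fun b hb p₀ => ?_⟩
  obtain ⟨p, hp, hpu⟩ := exists_unique_isVariationalSolution hT.le b
    (F := fun _ => 0) continuousOn_const p₀
  refine ⟨p, hp, hpu, ?_⟩
  have hF : ∀ η : LinftyVec d, ContinuousOn (fun t => flux (p t) η) (Set.Icc 0 T) := fun η =>
    (fluxL η).continuous.comp_continuousOn hp.1
  choose r hr hru using fun η : LinftyVec d =>
    exists_unique_isVariationalSolution hT.le b (hF η) 0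
  refine ⟨r, fun η => ⟨hr η, hru η⟩, fun τ hτ => ?_⟩
  have hτ' : τ ∈ Set.Icc 0 T := Set.Ioc_subset_Icc_self hτ
  have hexp : ∀ t ∈ Set.Icc 0 T, Real.exp (4 * M ^ 2 * t) ≤ E ^ 2 := by
    intro t ht
    rw [hE, ← Real.exp_nat_mul]
    refine Real.exp_le_exp.2 ?_
    have := mul_le_mul_of_nonneg_left ht.2 (sq_nonneg M)
    push_cast
    linarith
  have hpb : ∀ t ∈ Set.Icc 0 T, ‖p t‖ ≤ ‖p₀‖ * E := by
    intro t ht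
    have h1 := IsVariationalSolution.norm_sq_le hp continuousOn_const hb (C := 0)
      (fun _ _ => by simp) ht
    refine le_of_sq_le_sq (h1.trans ?_) (by positivity)
    rw [mul_pow, zero_pow two_ne_zero, mul_zero, zero_mul, add_zero]
    exact mul_le_mul_of_nonneg_left (hexp t ht) (sq_nonneg _)
  -- The combination of responses solves the problem for `η + c • η'`, so uniqueness identifies it.
  have hlin : ∀ (η η' : LinftyVec d) (c : ℝ), r (η + c • η') τ = r η τ + c • r η' τ := by
    intro η η' c
    have h := SpectralGradient.IsSolution.drift_add_smul (isVariationalSolution_iff.1 (hr η))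
      (isVariationalSolution_iff.1 (hr η')) hT.le (hF η) (hF η') c
    rw [smul_zero, add_zero] at h
    simp only [← flux_add_smul] at h
    exact (hru (η + c • η') _ (isVariationalSolution_iff.2 h) hτ').symm
  have hbound : ∀ η, ‖r η τ‖ ≤ 2 * E * E * τ ^ (1 / 2 : ℝ) * ‖p₀‖ * ‖η‖ := by
    intro η
    have h1 := IsVariationalSolution.norm_sq_le (hr η) (hF η) hb (C := ‖p₀‖ * E * ‖η‖)
      (fun t ht => (norm_flux_le _ _).trans
        (mul_le_mul_of_nonneg_right (hpb t ht) (norm_nonneg _))) hτ'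
    have hτ0 := hτ.1.le
    refine le_of_sq_le_sq (h1.trans ?_) (by positivity)
    rw [norm_zero, zero_pow two_ne_zero, zero_add]
    refine (mul_le_mul_of_nonneg_left (hexp τ hτ') (by positivity)).trans_eq ?_
    rw [← Real.sqrt_eq_rpow]
    simp only [mul_pow, Real.sq_sqrt hτ0]
    ring
  have hL : IsLinearMap ℝ (fun η => r η τ) := by
    -- The choice `c = -1` makes the right-hand side `r 0 τ - r 0 τ`.
    have h0 : r 0 τ = 0 := by simpa using hlin 0 0 (-1)
    refine ⟨fun η η' => by simpa using hlin η η' 1, fun c η => ?_⟩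
    have := hlin 0 η c
    rwa [zero_add, h0, zero_add] at this
  refine ⟨hL, ?_, hbound, fun η => ?_⟩
  · exact ((hL.mk' _).mkContinuous (2 * E * E * τ ^ (1 / 2 : ℝ) * ‖p₀‖) hbound).continuous
  · rw [IsVariationalSolution.integral_eq (hr η) hτ']
    exact MeasureTheory.integral_eq_zero_of_ae (MeasureTheory.Lp.coeFn_zero ℝ 2 _)
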